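/- Let $n\in\mathbb N$, let $\pi$ be a probability distribution on $\mathbb R^{n\times n}$, let $M\sim\pi$, and assume that every entry of $M$ has finite variance and that $\mathbb E[M]$ (taken entrywise) has full rank; put $\sigma:=\lambda_{\min}(\mathbb E[M]^T\mathbb E[M])$. Let $h:\mathbb R^n\to\mathbb R$ be twice continuously differentiable, let $P:\mathbb R^n\to\mathbb R\cup\{\infty\}$ be proper and lower semicontinuous, and let $\phi:\mathbb R^n\to\mathbb R$ be convex and twice continuously differentiable, with Bregman distance $D_\phi(u,w)=\phi(u)-\phi(w)-\langle\nabla\phi(w),u-w\rangle$. Norms are Euclidean. For $f:\mathbb R^n\to\mathbb R\cup\{\infty\}$, $\partial f$ denotes the limiting subdifferential: $v\in\partial f(x)$ if $f(x)<\infty$ and there are $x^k\to x$ with $f(x^k)\to f(x)$ and $v^k\to v$ such that $f(x^k)<\infty$ and $f(u)\ge f(x^k)+\langle v^k,u-x^k\rangle+o(\|u-x^k\|)$ as $u\to x^k$, for every $k$. The critical points of $f$ are the $x$ with $0\in\partial f(x)$. Sampling. Let $M^1,M^2,\dots$ be i.i.d. with distribution $\pi$, and let $\epsilon>0$. For $t\ge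 0$ let $\theta_t$ be $t^{2+\epsilon}$, rounded up or down to an integer. If every entry $M_{i,j}$ is sub-Gaussian, i.e. $\mathbb E[\exp(M_{i,j}^2/K)]\le 2$ for some $K>0$, then one may instead let $\theta_t$ be $t^{1+\epsilon}$, rounded in the same way. Algorithm (Meta-ISAD). Starting from arbitrary $x_0,z_0\in\mathbb R^n$ and $\beta_0>0$ (and with an arbitrary matrix $\bar M^0$), for $t=0,1,2,\dots$: $$\bar M^{t+1}=\frac{\theta_t}{\theta_{t+1}}\bar M^t+\frac1{\theta_{t+1}}\sum_{i=\theta_t+1}^{\theta_{t+1}}M^i,$$ $$y_{t+1}\in\operatorname*{argmin}_y\Big\{P(y)+\langle z_t,y\rangle+\frac{\beta_t}2\|\bar M^{t+1}x_t-y\|^2\Big\},$$ $$x_{t+1}\ \text{is a critical point of}\ \ g^{t+1}(x):=h(x)-\langle z_t,\bar M^tx\rangle+\frac{\beta_t}2\|\bar M^{t+1}x-y_{t+1}\|^2+D_\phi(x,x_t),$$ $$z_{t+1}=z_t-\beta_t(\bar M^{t+1}x_{t+1}-y_{t+1}),$$ and an adaptive penalty oracle, which may use any arguments, returns $\beta_{t+1}>0$.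 For $F:\mathbb R^n\to\mathbb R^n$ let $L^e_F$ be the empirical Lipschitz constant along the iterates, that is, the supremum of $\|F(x_{t+1})-F(x_t)\|/\|x_{t+1}-x_t\|$ over all $t\ge0$ with $x_{t+1}\ne x_t$ (and $0$ if there is no such $t$). Assume that almost surely the oracle satisfies the following: there are an index $K>0$ and a number $\rho>0$ (both may depend on the realization) such that for all $k>K$ $$\beta_k=\beta_K,\qquad g^{k+1}(x_{k+1})-g^{k+1}(x_k)\le-\frac\rho2\|x_{k+1}-x_k\|^2,\qquad \rho>\frac{8}{\beta_k\sigma}\Big(\big(L^e_{\nabla h+\nabla\phi}\big)^2+\big(L^e_{\nabla\phi}\big)^2\Big).$$ Assume also that almost surely the sequence $(x_t,y_t,z_t)_{t>0}$ is bounded. Then almost surely, for every cluster point $(x^*,y^*,z^*)$ of $(x_t,y_t,z_t)_{t>0}$, the point $x^*$ is a critical point of the function $x\mapsto h(x)+P(\mathbb E[M]x)$. -/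

import Mathlib

open MeasureTheory ProbabilityTheory Filter Topology
open scoped Gradient RealInnerProductSpace

namespace ISAD

noncomputable section

/-- `ℝⁿ` with the Euclidean norm. -/
abbrev Vec (n : ℕ) : Type := EuclideanSpace ℝ (Fin n)

/-- Real `n × n` matrices. -/
abbrev Mat (n : ℕ) : Type := Matrix (Fin n) (Fin n) ℝ

/-- The product (entrywise) σ-algebra on matrices. -/
instance matMeasurableSpace (n : ℕ) : MeasurableSpace (Mat n) :=
  inferInstanceAs (MeasurableSpace (Fin n → Fin n → ℝ))

/-! ### Variational analysis -/

/-- `f : ℝⁿ → ℝ ∪ {∞}` is proper: it never takes the value `-∞` and is not identically `∞`. -/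
def IsProper {n : ℕ} (f : Vec n → EReal) : Prop :=
  (∀ x, f x ≠ ⊥) ∧ ∃ x, f x ≠ ⊤

/-- `v` is a regular (Fréchet) subgradient of `f` at `x`: `f x` is finite and
`f z ≥ f x + ⟪v, z - x⟫ + o(‖z - x‖)` as `z → x`. -/
def IsRegularSubgradient {n : ℕ} (f : Vec n → EReal) (x v : Vec n) : Prop :=
  f x ≠ ⊤ ∧ f x ≠ ⊥ ∧
    ∀ η : ℝ, 0 < η → ∀ᶠ w in 𝓝 x, f x + ((⟪v, w - x⟫ - η * ‖w - x‖ : ℝ) : EReal) ≤ f w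

/-- The (limiting) subdifferential `∂f(x)`: limits of regular subgradients at points `xs t → x`
with `f (xs t) → f x`. It is empty where `f` is not finite. -/
def subdiff {n : ℕ} (f : Vec n → EReal) (x : Vec n) : Set (Vec n) :=
  {v | f x ≠ ⊤ ∧ f x ≠ ⊥ ∧ ∃ xs vs : ℕ → Vec n,
    Tendsto xs atTop (𝓝 x) ∧ Tendsto (fun t => f (xs t)) atTop (𝓝 (f x)) ∧
    Tendsto vs atTop (𝓝 v) ∧ ∀ t, IsRegularSubgradient f (xs t) (vs t)}

/-- The set of critical points `{x | 0 ∈ ∂f(x)}`. -/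
def crit {n : ℕ} (f : Vec n → EReal) : Set (Vec n) :=
  {x | (0 : Vec n) ∈ subdiff f x}

/-- The set of global minimizers. -/
def argmin {n : ℕ} (f : Vec n → EReal) : Set (Vec n) :=
  {x | ∀ u, f x ≤ f u}

/-- The Bregman distance `D_φ(u, w) = φ(u) - φ(w) - ⟪∇φ(w), u - w⟫`. -/
def bregman {n : ℕ} (φ : Vec n → ℝ) (u w : Vec n) : ℝ :=
  φ u - φ w - ⟪∇ φ w, u - w⟫

/-- The empirical Lipschitz constant of `F` along a sequence: the supremum of
`‖F (x (t+1)) - F (x t)‖ / ‖x (t+1) - x t‖` over all `t` with `x (t+1) ≠ x t`, and `0` (the value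
of `sSup ∅`) if there is no such `t`. -/
def eLip {n : ℕ} (F : Vec n → Vec n) (x : ℕ → Vec n) : ℝ :=
  sSup {r : ℝ | ∃ t, x (t + 1) ≠ x t ∧ r = ‖F (x (t + 1)) - F (x t)‖ / ‖x (t + 1) - x t‖}

/-! ### The random matrix -/

/-- The expectation `E[M]` of a random matrix with distribution `π`, taken entrywise. -/
def expMat {n : ℕ} (π : Measure (Mat n)) : Mat n :=
  Matrix.of fun i j => ∫ A, A i j ∂π

/-- The smallest eigenvalue of a (symmetric) matrix. -/
def lambdaMin {n : ℕ} (A : Mat n) : ℝ := sInf (spectrum ℝ A)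

/-- The real random variable `X` is sub-Gaussian: `E[exp(X² / K)] ≤ 2` for some `K > 0`. -/
def IsSubGaussian {Ω : Type*} [MeasurableSpace Ω] (X : Ω → ℝ) (μ : Measure Ω) : Prop :=
  ∃ K : ℝ, 0 < K ∧ ∫⁻ ω, ENNReal.ofReal (Real.exp (X ω ^ 2 / K)) ∂μ ≤ 2

/-- The sampling regime: the number `θ t` of samples collected by round `t` is `t ^ (2 + ε)`, or
`t ^ (1 + ε)` if all entries of the random matrix are sub-Gaussian. These powers need not be
integers, and `θ t` is obtained from them by rounding up or down. -/
def IsSamplingRegime {n : ℕ} (π : Measure (Mat n)) (ε : ℝ) (θ : ℕ → ℕ) : Prop :=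
  ((∀ i j, IsSubGaussian (fun A : Mat n => A i j) π) ∧
      ∀ t : ℕ, |(θ t : ℝ) - (t : ℝ) ^ (1 + ε)| < 1) ∨
    ∀ t : ℕ, |(θ t : ℝ) - (t : ℝ) ^ (2 + ε)| < 1

/-! ### The algorithm -/

/-- The function `u ↦ h(u) - ⟪z, A u⟫ + (β/2) ‖A' u - y‖² + D_φ(u, w)` of the `x` update.
With `A, A', β, z, y, w = M̄ᵗ, M̄ᵗ⁺¹, β_t, z_t, y_{t+1}, x_t` it is `gᵗ⁺¹`. -/
def gFun {n : ℕ} (h φ : Vec n → ℝ) (A A' : Mat n) (β : ℝ) (z y w u : Vec n) : ℝ :=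
  h u - ⟪z, A.toEuclideanLin u⟫ + β / 2 * ‖A'.toEuclideanLin u - y‖ ^ 2 + bregman φ u w

/-- `(Mbar, x, y, z, β)` is a run of Meta-ISAD on the sampled matrices `M 0, M 1, …`, where `M i` is
the `(i+1)`-st sample. The starting values `x 0`, `z 0` and `β 0 > 0` are arbitrary.
Nothing is asked of `y 0`, which the algorithm does not use, nor of `Mbar 0`, the average of no
samples. The penalty oracle may use any arguments, so it enters only through the positive numbers
`β (t+1)` that it returns. -/
structure IsRun {n : ℕ} (h φ : Vec n → ℝ) (P : Vec n → EReal) (θ : ℕ → ℕ) (M : ℕ → Mat n)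
    (Mbar : ℕ → Mat n) (x y z : ℕ → Vec n) (β : ℕ → ℝ) : Prop where
  average : ∀ t, Mbar (t + 1) =
    ((θ t : ℝ) / (θ (t + 1) : ℝ)) • Mbar t
      + ((1 : ℝ) / (θ (t + 1) : ℝ)) • ∑ i ∈ Finset.Ico (θ t) (θ (t + 1)), M i
  y_update : ∀ t, y (t + 1) ∈ argmin fun v =>
    P v + ((⟪z t, v⟫ + β t / 2 * ‖(Mbar (t + 1)).toEuclideanLin (x t) - v‖ ^ 2 : ℝ) : EReal)
  x_update : ∀ t, x (t + 1) ∈ crit fun u =>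
    ((gFun h φ (Mbar t) (Mbar (t + 1)) (β t) (z t) (y (t + 1)) (x t) u : ℝ) : EReal)
  z_update : ∀ t, z (t + 1) =
    z t - β t • ((Mbar (t + 1)).toEuclideanLin (x (t + 1)) - y (t + 1))
  penalty_pos : ∀ t, 0 < β t

/-- The requirements on the adaptive penalty oracle, for the penalties `β` that it returned along a
run; here `σ` is the smallest eigenvalue of `E[M]ᵀ E[M]`. -/
def SatisfiesAPO {n : ℕ} (h φ : Vec n → ℝ) (σ : ℝ) (Mbar : ℕ → Mat n) (x y z : ℕ → Vec n)
    (β : ℕ → ℝ) : Prop :=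
  ∃ K : ℕ, 0 < K ∧
    (∀ k, K < k → β k = β K) ∧
    ∃ ρ : ℝ, 0 < ρ ∧ ∀ k, K < k →
      gFun h φ (Mbar k) (Mbar (k + 1)) (β k) (z k) (y (k + 1)) (x k) (x (k + 1))
          - gFun h φ (Mbar k) (Mbar (k + 1)) (β k) (z k) (y (k + 1)) (x k) (x k)
        ≤ -(ρ / 2) * ‖x (k + 1) - x k‖ ^ 2 ∧
      8 / (β k * σ) * (eLip (fun u => ∇ h u + ∇ φ u) x ^ 2 + eLip (∇ φ) x ^ 2) < ρ

/-- The iterates `(x t, y t, z t)`, `t > 0`, are bounded. -/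
def BoundedIterates {n : ℕ} (x y z : ℕ → Vec n) : Prop :=
  ∃ B : ℝ, ∀ t, 0 < t → ‖x t‖ ≤ B ∧ ‖y t‖ ≤ B ∧ ‖z t‖ ≤ B

end

end ISAD

/-! The randomness enters only through two almost sure facts about the averages `Mbar`: they
converge to `E[M]`, and their increments are absolutely summable. The first is the strong law. For
the second, the average of `l` samples minus that of the first `k` has variance `(1/k - 1/l) Var`;
with about `t ^ p` samples its L² norm is of order `t ^ (-(p + 1) / 2)`, which is summable because
`p > 1` (`ae_summable_sampleMean_increments`, `ae_average_tendsto`).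

The rest is deterministic and concerns one realization, after the penalty has become a constant `β`.
In one round the augmented Lagrangian drops by `ρ/2 ‖Δx‖²`, rises by `‖Δz‖² / β`, and is perturbed
by a multiple of the operator increment (`augLag_step`). Stationarity of the `x` update expresses
the adjoint applied to `z` through gradients of `h` and `φ`; since the adjoint is bounded below in
terms of `σ`, `‖Δz‖²` is controlled by two consecutive `‖Δx‖²` (`multiplier_step`). The lower bound
on `ρ` makes the net decrease positive, so `‖Δx‖²` is summable and `Δx`, `Δz` tend to zero
(`tendsto_increments`).

At a cluster point, `Δz → 0` forces `E[M] x* = y*`, and stationarity passes to `∇h(x*) = E[M]ᵀ z*`.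
The `y` update gives subgradients of `P` at the `y` iterates; as `E[M]` is invertible these points
can be pulled back, yielding regular subgradients of `h + P ∘ E[M]` that tend to `0`
(`mem_crit_of_tendsto`). -/

namespace ISAD

/-! ### Gradient calculus and the convex gradient inequality. -/

section Gradient

variable {E : Type*} [NormedAddCommGroup E] [InnerProductSpace ℝ E] [CompleteSpace E]

theorem hasGradientAt_of_hasFDerivAt {f : E → ℝ} {f' : E →L[ℝ] ℝ} {g x : E}
    (hf : HasFDerivAt f f' x) (hg : ∀ u, f' u = ⟪g, u⟫) : HasGradientAt f g x := by
  rw [hasGradientAt_iff_hasFDerivAt]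
  have e : (InnerProductSpace.toDual ℝ E) g = f' := by
    ext u
    simp [hg]
  rw [e]
  exact hf

theorem hasGradientAt_add {f g : E → ℝ} {f' g' x : E} (hf : HasGradientAt f f' x)
    (hg : HasGradientAt g g' x) : HasGradientAt (fun u => f u + g u) (f' + g') x := by
  rw [hasGradientAt_iff_hasFDerivAt] at hf hg
  exact hasGradientAt_of_hasFDerivAt (hf.add hg) fun u => by simp [inner_add_left]

theorem hasGradientAt_sub {f g : E → ℝ} {f' g' x : E} (hf : HasGradientAt f f' x)
    (hg : HasGradientAt g g' x) : HasGradientAt (fun u => f u - g u) (f' - g') x := by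
  rw [hasGradientAt_iff_hasFDerivAt] at hf hg
  exact hasGradientAt_of_hasFDerivAt (hf.sub hg) fun u => by simp [inner_sub_left]

theorem hasGradientAt_inner_clm (T : E →L[ℝ] E) (z x : E) :
    HasGradientAt (fun u => ⟪z, T u⟫) (T.adjoint z) x := by
  refine hasGradientAt_of_hasFDerivAt
    (((innerSL ℝ z).comp T).hasFDerivAt (x := x)) fun u => ?_
  simp [ContinuousLinearMap.adjoint_inner_left]

theorem hasGradientAt_half_norm_sq (T : E →L[ℝ] E) (β : ℝ) (y x : E) :
    HasGradientAt (fun u => β / 2 * ‖T u - y‖ ^ 2) (β • T.adjoint (T x - y)) x := by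
  have h1 : HasFDerivAt (fun u => T u - y) T x := T.hasFDerivAt.sub_const y
  refine hasGradientAt_of_hasFDerivAt (h1.norm_sq.const_mul (β / 2)) fun u => ?_
  have e : ⟪β • T.adjoint (T x - y), u⟫ = β * ⟪T x - y, T u⟫ := by
    rw [real_inner_smul_left, ContinuousLinearMap.adjoint_inner_left]
  rw [e]
  simp [inner_sub_left]
  ring

theorem hasGradientAt_of_contDiff {f : E → ℝ} (hf : ContDiff ℝ 2 f) (x : E) :
    HasGradientAt f (∇ f x) x :=
  (hf.differentiable (by norm_num) x).hasGradientAt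

theorem contDiff_gradient {f : E → ℝ} (hf : ContDiff ℝ 2 f) : ContDiff ℝ 1 (∇ f) := by
  have h1 : ContDiff ℝ 1 (fderiv ℝ f) := hf.fderiv_right (by norm_num)
  exact (InnerProductSpace.toDual ℝ E).symm.toContinuousLinearEquiv.contDiff.comp h1

theorem _root_.HasGradientAt.eventually_abs_sub_le {f : E → ℝ} {f' x : E} (hf : HasGradientAt f f' x)
    {η : ℝ} (hη : 0 < η) :
    ∀ᶠ w in 𝓝 x, |f w - f x - ⟪f', w - x⟫| ≤ η * ‖w - x‖ := by
  rw [hasGradientAt_iff_isLittleO] at hf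
  simpa using hf.bound hη

theorem le_add_inner_of_convexOn {f : E → ℝ} (hf : ConvexOn ℝ Set.univ f) {f' x : E}
    (hx : HasGradientAt f f' x) (u : E) : f x + ⟪f', u - x⟫ ≤ f u := by
  have hline : HasDerivAt (fun t : ℝ => x + t • (u - x)) (u - x) 0 := by
    simpa using ((hasDerivAt_id (0 : ℝ)).smul_const (u - x)).const_add x
  have hx' : HasFDerivAt f ((InnerProductSpace.toDual ℝ E) f') (x + (0 : ℝ) • (u - x)) := by
    simpa using hasGradientAt_iff_hasFDerivAt.1 hx
  have hd : HasDerivAt (fun t : ℝ => f (x + t • (u - x))) ⟪f', u - x⟫ 0 := by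
    exact hx'.comp_hasDerivAt (0 : ℝ) hline
  have hc : ConvexOn ℝ Set.univ (fun t : ℝ => f (x + t • (u - x))) := by
    have := hf.comp_affineMap (AffineMap.lineMap x u)
    simpa [Function.comp_def, AffineMap.lineMap_apply, add_comm] using this
  have h1 := hc.le_slope_of_hasDerivAt (Set.mem_univ 0) (Set.mem_univ 1) one_pos hd
  simp [slope_def_field] at h1
  linarith

end Gradient

/-! ### Matrices as operators. -/

variable {n : ℕ}

/-- A matrix as a continuous linear operator on Euclidean space. -/
noncomputable def toCLM (A : Mat n) : Vec n →L[ℝ] Vec n := Matrix.toEuclideanCLM (𝕜 := ℝ) A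

theorem toEuclideanLin_eq_toCLM (A : Mat n) (u : Vec n) : A.toEuclideanLin u = toCLM A u := rfl

theorem adjoint_toCLM (A : Mat n) : (toCLM A).adjoint = toCLM A.transpose := by
  have h := map_star (Matrix.toEuclideanCLM (n := Fin n) (𝕜 := ℝ)) A
  rw [Matrix.star_eq_conjTranspose, Matrix.conjTranspose_eq_transpose_of_trivial] at h
  exact h.symm

theorem toCLM_mul (A B : Mat n) : toCLM (A * B) = (toCLM A).comp (toCLM B) :=
  map_mul (Matrix.toEuclideanCLM (n := Fin n) (𝕜 := ℝ)) A B

theorem toCLM_sub (A B : Mat n) : toCLM (A - B) = toCLM A - toCLM B :=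
  map_sub (Matrix.toEuclideanCLM (n := Fin n) (𝕜 := ℝ)) A B

theorem toCLM_smul (c : ℝ) (A : Mat n) : toCLM (c • A) = c • toCLM A :=
  map_smul (Matrix.toEuclideanCLM (n := Fin n) (𝕜 := ℝ)) c A

theorem toCLM_one : toCLM (1 : Mat n) = ContinuousLinearMap.id ℝ _ :=
  map_one (Matrix.toEuclideanCLM (n := Fin n) (𝕜 := ℝ))

theorem continuous_toCLM : Continuous (toCLM (n := n)) :=
  (Matrix.toEuclideanCLM (n := Fin n) (𝕜 := ℝ)).toAlgEquiv.toLinearEquiv.toLinearMap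
    |>.continuous_of_finiteDimensional

/-- The operator norm of a matrix is at most the sum of the absolute values of its entries. -/
theorem norm_toCLM_le (A : Mat n) : ‖toCLM A‖ ≤ ∑ i, ∑ j, |A i j| := by
  refine ContinuousLinearMap.opNorm_le_bound _ (by positivity) fun u => ?_
  have h1 : ‖toCLM A u‖ ≤ ∑ i, ‖toCLM A u i‖ := by
    have : toCLM A u = ∑ i, (toCLM A u i) • EuclideanSpace.single i (1 : ℝ) := by
      ext k; simp [Finset.sum_apply, Pi.single_apply]
    calc ‖toCLM A u‖ = ‖∑ i, (toCLM A u i) • EuclideanSpace.single i (1 : ℝ)‖ := by rw [← this]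
      _ ≤ _ := (norm_sum_le _ _).trans (le_of_eq (by simp [norm_smul]))
  refine h1.trans ?_
  rw [Finset.sum_mul]
  refine Finset.sum_le_sum fun i _ => ?_
  have h2 : toCLM A u i = ∑ j, A i j * u j := rfl
  rw [h2, Finset.sum_mul]
  refine (norm_sum_le _ _).trans (Finset.sum_le_sum fun j _ => ?_)
  rw [norm_mul, Real.norm_eq_abs]
  exact mul_le_mul_of_nonneg_left (PiLp.norm_apply_le u j) (abs_nonneg _)

/-! ### Subgradients of smooth functions, stationarity of the `x` update, empirical Lipschitz
constants. -/

section Subdifferential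

/-- Moving from `x` a small distance along `d = v - f'`, the subgradient inequality and the gradient
expansion, each with error `‖d‖ / 4` per unit length, give `‖d‖² ≤ ‖d‖² / 2`. -/
theorem IsRegularSubgradient.eq_of_hasGradientAt {f : Vec n → ℝ} {f' x v : Vec n}
    (hv : IsRegularSubgradient (fun u => (f u : EReal)) x v) (hf : HasGradientAt f f' x) :
    v = f' := by
  by_contra hne
  set d := v - f' with hd
  have hdpos : 0 < ‖d‖ := norm_pos_iff.2 (sub_ne_zero.2 hne)
  have hη : 0 < ‖d‖ / 4 := by positivity
  have h1 := (hv.2.2 _ hη).and (HasGradientAt.eventually_abs_sub_le hf hη)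
  have hline : Tendsto (fun t : ℝ => x + t • d) (𝓝[>] 0) (𝓝 x) := by
    have : Tendsto (fun t : ℝ => x + t • d) (𝓝 0) (𝓝 (x + (0 : ℝ) • d)) :=
      (by fun_prop : Continuous fun t : ℝ => x + t • d).tendsto 0
    simpa using this.mono_left nhdsWithin_le_nhds
  obtain ⟨t, ⟨ht1, ht2⟩, ht⟩ := ((hline.eventually h1).and self_mem_nhdsWithin).exists
  have ht : 0 < t := ht
  have ht1' : f x + (⟪v, x + t • d - x⟫ - ‖d‖ / 4 * ‖x + t • d - x‖) ≤ f (x + t • d) := by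
    rw [← EReal.coe_le_coe_iff, EReal.coe_add]
    exact ht1
  have h3 := (abs_le.1 ht2).2
  simp only [add_sub_cancel_left, inner_smul_right, norm_smul, Real.norm_eq_abs, abs_of_pos ht]
    at ht1' h3
  have h4 : ⟪v, d⟫ - ⟪f', d⟫ = ‖d‖ ^ 2 := by
    rw [← inner_sub_left, ← hd, real_inner_self_eq_norm_sq]
  have : t * (⟪v, d⟫ - ⟪f', d⟫) ≤ t * (‖d‖ ^ 2 / 2) := by nlinarith
  rw [h4] at this
  have := le_of_mul_le_mul_left this ht
  nlinarith

theorem gradient_eq_zero_of_mem_crit {f : Vec n → ℝ} {G : Vec n → Vec n}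
    (hf : ∀ u, HasGradientAt f (G u) u) (hG : Continuous G) {x : Vec n}
    (hx : x ∈ crit fun u => (f u : EReal)) : G x = 0 := by
  obtain ⟨-, -, xs, vs, hxs, -, hvs, hreg⟩ := hx
  have : vs = fun t => G (xs t) := funext fun t => (hreg t).eq_of_hasGradientAt (hf _)
  rw [this] at hvs
  exact tendsto_nhds_unique ((hG.tendsto x).comp hxs) hvs

theorem mem_crit_of_isMin {f : Vec n → EReal} {x : Vec n} (htop : f x ≠ ⊤) (hbot : f x ≠ ⊥)
    (hx : ∀ u, f x ≤ f u) : x ∈ crit f := by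
  refine ⟨htop, hbot, fun _ => x, fun _ => 0, tendsto_const_nhds, tendsto_const_nhds,
    tendsto_const_nhds, fun _ => ⟨htop, hbot, fun η hη => Eventually.of_forall fun w => ?_⟩⟩
  refine le_trans ?_ (hx w)
  calc f x + ((⟪(0 : Vec n), w - x⟫ - η * ‖w - x‖ : ℝ) : EReal) ≤ f x + 0 := by
        gcongr
        rw [inner_zero_left, zero_sub]
        exact_mod_cast neg_nonpos.2 (by positivity)
    _ = f x := add_zero _

end Subdifferential

theorem bregman_nonneg {φ : Vec n → ℝ} (hφ : ContDiff ℝ 2 φ) (hc : ConvexOn ℝ Set.univ φ)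
    (u w : Vec n) : 0 ≤ bregman φ u w := by
  have := le_add_inner_of_convexOn hc (hasGradientAt_of_contDiff hφ w) u
  unfold bregman
  linarith

theorem hasGradientAt_gFun {h φ : Vec n → ℝ} (hh : ContDiff ℝ 2 h) (hφ : ContDiff ℝ 2 φ)
    (A A' : Mat n) (β : ℝ) (z y w u : Vec n) :
    HasGradientAt (gFun h φ A A' β z y w)
      (∇ h u - (toCLM A).adjoint z + β • (toCLM A').adjoint (toCLM A' u - y)
        + (∇ φ u - ∇ φ w)) u := by
  have hb : HasGradientAt (fun u => bregman φ u w) (∇ φ u - ∇ φ w) u := by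
    have h1 : HasGradientAt (fun u => φ u - φ w) (∇ φ u) u := by
      simpa using hasGradientAt_sub (hasGradientAt_of_contDiff hφ u) (hasGradientAt_const u (φ w))
    have h2 : HasGradientAt (fun u => ⟪∇ φ w, u - w⟫) (∇ φ w) u :=
      hasGradientAt_of_hasFDerivAt (f' := innerSL ℝ (∇ φ w))
        ((innerSL ℝ (∇ φ w)).hasFDerivAt.comp u ((hasFDerivAt_id u).sub_const w)) fun v => by simp
    exact hasGradientAt_sub h1 h2
  have h1 := hasGradientAt_sub (hasGradientAt_of_contDiff hh u)
    (hasGradientAt_inner_clm (toCLM A) z u)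
  have h2 := hasGradientAt_add h1 (hasGradientAt_half_norm_sq (toCLM A') β y u)
  exact hasGradientAt_add h2 hb

theorem gFun_stationarity {h φ : Vec n → ℝ} (hh : ContDiff ℝ 2 h) (hφ : ContDiff ℝ 2 φ)
    {A A' : Mat n} {β : ℝ} {z y w x : Vec n}
    (hx : x ∈ crit fun u => (gFun h φ A A' β z y w u : EReal)) :
    ∇ h x - (toCLM A).adjoint z + β • (toCLM A').adjoint (toCLM A' x - y)
        + (∇ φ x - ∇ φ w) = 0 := by
  refine gradient_eq_zero_of_mem_crit (f := gFun h φ A A' β z y w)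
    (fun u => hasGradientAt_gFun hh hφ A A' β z y w u) ?_ hx
  have h1 := (contDiff_gradient hh).continuous
  have h2 := (contDiff_gradient hφ).continuous
  fun_prop

/-- A real `sSup` is an upper bound only if the set of quotients is bounded; this holds because a C¹
map is Lipschitz on a closed ball containing the iterates. -/
theorem eLip_spec {F : Vec n → Vec n} (hF : ContDiff ℝ 1 F) {x : ℕ → Vec n} {B : ℝ}
    (hx : ∀ t, ‖x t‖ ≤ B) (t : ℕ) :
    ‖F (x (t + 1)) - F (x t)‖ ≤ eLip F x * ‖x (t + 1) - x t‖ := by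
  rcases eq_or_ne (x (t + 1)) (x t) with h | h
  · simp [h]
  have hpos : ∀ s, x (s + 1) ≠ x s → 0 < ‖x (s + 1) - x s‖ := fun s hs =>
    norm_pos_iff.2 (sub_ne_zero.2 hs)
  obtain ⟨C, hC⟩ := hF.contDiffOn.exists_lipschitzOnWith (s := Metric.closedBall 0 B)
    one_ne_zero (convex_closedBall _ _) (isCompact_closedBall _ _)
  rw [← div_le_iff₀ (hpos t h)]
  refine le_csSup ⟨C, ?_⟩ ⟨t, h, rfl⟩
  rintro r ⟨s, hs, rfl⟩
  rw [div_le_iff₀ (hpos s hs)]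
  exact hC.norm_sub_le (by simpa using hx (s + 1)) (by simpa using hx s)

end ISAD

/-! ### Descent of the augmented Lagrangian under summable operator perturbations. -/

namespace ISAD

/-- A perturbed descent inequality forces the decrements to be summable. -/
theorem summable_of_perturbed_descent {V a e : ℕ → ℝ} {c m : ℝ} (hc : 0 < c)
    (ha : ∀ t, 0 ≤ a t) (he : ∀ t, 0 ≤ e t) (hes : Summable e) (hm : ∀ t, m ≤ V t)
    (hV : ∀ t, V (t + 1) ≤ V t - c * a t + e t) : Summable a := by
  have key : ∀ N, c * ∑ t ∈ Finset.range N, a t ≤ V 0 - V N + ∑ t ∈ Finset.range N, e t := by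
    intro N
    induction N with
    | zero => simp
    | succ N ih =>
      rw [Finset.sum_range_succ, Finset.sum_range_succ]
      linarith [hV N]
  refine summable_of_sum_range_le (c := (V 0 - m + ∑' t, e t) / c) ha fun N => ?_
  rw [le_div_iff₀ hc]
  linarith [key N, hm N, hes.sum_le_tsum (Finset.range N) fun t _ => he t]

/-- Descent up to multiplier increments that are themselves controlled by the increments of the
primal variable: the squared primal increments are summable. -/
theorem summable_sq_of_lagrangian_descent {β ρ σ L₁ L₂ C₁ C₂ m : ℝ} (hβ : 0 < β) (hσ : 0 < σ)
    (hρ : 8 / (β * σ) * (L₁ ^ 2 + L₂ ^ 2) < ρ) (hC₁ : 0 ≤ C₁) (hC₂ : 0 ≤ C₂)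
    {ℓ d D s : ℕ → ℝ} (hD : ∀ t, 0 ≤ D t) (hDs : Summable D) (hm : ∀ t, m ≤ ℓ t)
    (hℓ : ∀ t, ℓ (t + 1) ≤ ℓ t - ρ / 2 * d t ^ 2 + s t / β + C₁ * D t)
    (hs : ∀ t, s (t + 1) ≤ 4 / σ * (L₁ ^ 2 * d (t + 1) ^ 2 + L₂ ^ 2 * d t ^ 2) + C₂ * D t) :
    Summable fun t => d t ^ 2 := by
  -- The bound on `s (t + 1)` involves the older increment `d t`, so a multiple of `d t ^ 2` is
  -- added to `ℓ (t + 1)` as a potential. Both coefficients are then charged to `d (t + 1) ^ 2`, and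
  -- `hρ` says exactly that `c > 0`.
  refine (summable_nat_add_iff 1).1 (summable_of_perturbed_descent (m := m)
    (V := fun t => ℓ (t + 1) + 4 / σ * L₂ ^ 2 / β * d t ^ 2)
    (e := fun t => C₁ * D (t + 1) + C₂ / β * D t)
    (c := ρ / 2 - 4 / σ * L₁ ^ 2 / β - 4 / σ * L₂ ^ 2 / β) ?_
    (fun t => sq_nonneg _) (fun t => ?_) ?_ (fun t => ?_) (fun t => ?_))
  · have : 8 / (β * σ) * (L₁ ^ 2 + L₂ ^ 2)
        = 2 * (4 / σ * L₁ ^ 2 / β + 4 / σ * L₂ ^ 2 / β) := by field_simp; ring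
    linarith
  · exact add_nonneg (mul_nonneg hC₁ (hD _)) (mul_nonneg (div_nonneg hC₂ hβ.le) (hD _))
  · exact (((summable_nat_add_iff 1).2 hDs).mul_left _).add (hDs.mul_left _)
  · have h2 : 0 ≤ 4 / σ * L₂ ^ 2 / β * d t ^ 2 := by positivity
    linarith [hm (t + 1)]
  · have h2 := div_le_div_of_nonneg_right (hs t) hβ.le
    have h3 : (4 / σ * (L₁ ^ 2 * d (t + 1) ^ 2 + L₂ ^ 2 * d t ^ 2) + C₂ * D t) / β
        = 4 / σ * L₁ ^ 2 / β * d (t + 1) ^ 2 + 4 / σ * L₂ ^ 2 / β * d t ^ 2 + C₂ / β * D t := by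
      ring
    linarith [hℓ (t + 1)]

theorem sq_add_add_le (a b c : ℝ) : (a + b + c) ^ 2 ≤ 3 * (a ^ 2 + b ^ 2 + c ^ 2) := by
  nlinarith [sq_nonneg (a - b), sq_nonneg (b - c), sq_nonneg (a - c)]

variable {E : Type*} [NormedAddCommGroup E] [InnerProductSpace ℝ E]

/-- The augmented Lagrangian with objective value `H`, penalty `β` and operator `T`. -/
noncomputable def augLag (H β : ℝ) (T : E →L[ℝ] E) (x y z : E) : ℝ :=
  H - ⟪z, T x - y⟫ + β / 2 * ‖T x - y‖ ^ 2

/-- Changing `z` to `z'` costs `β ‖r‖² = ‖z' - z‖² / β`, with `r` the new residual. The three terms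
in the last factor pay for replacing `T` by `T'`: in `⟪z, T x'⟫`, and in the cross and square terms
of `‖T' x - y‖²` expanded around `T x - y`. -/
theorem augLag_step {β ρ B C H H' p p' : ℝ} (hβ : 0 < β)
    {T T' : E →L[ℝ] E} {x y z x' y' z' : E}
    (hx : ‖x‖ ≤ B) (hy : ‖y‖ ≤ B) (hz : ‖z‖ ≤ B) (hx' : ‖x'‖ ≤ B)
    (hT : ‖T‖ ≤ C) (hT' : ‖T'‖ ≤ C)
    (hyup : p' + (⟪z, y'⟫ + β / 2 * ‖T' x - y'‖ ^ 2) ≤ p + (⟪z, y⟫ + β / 2 * ‖T' x - y‖ ^ 2))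
    (hxup : H' - ⟪z, T x'⟫ + β / 2 * ‖T' x' - y'‖ ^ 2
      ≤ H - ⟪z, T x⟫ + β / 2 * ‖T' x - y'‖ ^ 2 - ρ / 2 * ‖x' - x‖ ^ 2)
    (hzup : z' = z - β • (T' x' - y')) :
    augLag (H' + p') β T' x' y' z' ≤ augLag (H + p) β T x y z - ρ / 2 * ‖x' - x‖ ^ 2
      + ‖z' - z‖ ^ 2 / β
      + (B ^ 2 + β * (B * (C * B + B)) + β / 2 * (B * (2 * C * B))) * ‖T' - T‖ := by
  set D := T' - T with hD
  set r := T' x' - y' with hr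
  have hB : 0 ≤ B := (norm_nonneg _).trans hx
  have hC : 0 ≤ C := (norm_nonneg _).trans hT
  have hDC : ‖D‖ ≤ 2 * C := (norm_sub_le _ _).trans (by linarith)
  have hzz : ‖z' - z‖ ^ 2 / β = β * ‖r‖ ^ 2 := by
    have : z' - z = -(β • r) := by rw [hzup]; abel
    rw [this, norm_neg, norm_smul, Real.norm_eq_abs, abs_of_pos hβ]
    field_simp
  have hz'r : ⟪z', r⟫ = ⟪z, r⟫ - β * ‖r‖ ^ 2 := by
    rw [hzup, inner_sub_left, real_inner_smul_left, real_inner_self_eq_norm_sq]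
  have hzr : ⟪z, r⟫ = ⟪z, T x'⟫ + ⟪z, D x'⟫ - ⟪z, y'⟫ := by
    rw [hr, hD, ← inner_add_right, ← inner_sub_right]
    simp
  have hDx : ‖D x‖ ≤ ‖D‖ * B := (D.le_opNorm x).trans (by gcongr)
  have hDx' : ‖D x'‖ ≤ ‖D‖ * B := (D.le_opNorm x').trans (by gcongr)
  have hTx : ‖T x - y‖ ≤ C * B + B := by
    refine (norm_sub_le _ _).trans (add_le_add ((T.le_opNorm x).trans ?_) hy)
    gcongr
  have e1 : -⟪z, D x'⟫ ≤ B ^ 2 * ‖D‖ := by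
    have h1 := (abs_le.1 (abs_real_inner_le_norm z (D x'))).1
    have h2 : ‖z‖ * ‖D x'‖ ≤ B * (‖D‖ * B) := by gcongr
    nlinarith
  have e2 : ‖T' x - y‖ ^ 2 = ‖T x - y‖ ^ 2 + 2 * ⟪T x - y, D x⟫ + ‖D x‖ ^ 2 := by
    rw [← norm_add_sq_real]
    congr 2
    simp [hD]
  have e3 : ⟪T x - y, D x⟫ ≤ (B * (C * B + B)) * ‖D‖ := by
    have h1 := (abs_le.1 (abs_real_inner_le_norm (T x - y) (D x))).2
    have h2 : ‖T x - y‖ * ‖D x‖ ≤ (C * B + B) * (‖D‖ * B) := by gcongr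
    nlinarith
  have e4 : ‖D x‖ ^ 2 ≤ (B * (2 * C * B)) * ‖D‖ := by
    have h2 : ‖D x‖ * ‖D x‖ ≤ (2 * C * B) * (‖D‖ * B) := by
      gcongr
      exact hDx.trans (by gcongr)
    nlinarith
  have e5 := mul_le_mul_of_nonneg_left e3 hβ.le
  have e6 := mul_le_mul_of_nonneg_left e4 (half_pos hβ).le
  have hTxy : ⟪z, T x - y⟫ = ⟪z, T x⟫ - ⟪z, y⟫ := inner_sub_right _ _ _
  unfold augLag
  rw [← hr, hzz, hz'r, hzr, hTxy]
  rw [e2] at hyup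
  linarith

theorem augLag_lower_bound {β B C H : ℝ} (hβ : 0 < β) {T : E →L[ℝ] E} {x y z : E}
    (hx : ‖x‖ ≤ B) (hy : ‖y‖ ≤ B) (hz : ‖z‖ ≤ B) (hT : ‖T‖ ≤ C) :
    H - B * (C * B + B) ≤ augLag H β T x y z := by
  have hB : 0 ≤ B := (norm_nonneg _).trans hx
  have hC : 0 ≤ C := (norm_nonneg _).trans hT
  have hTx : ‖T x - y‖ ≤ C * B + B := by
    refine (norm_sub_le _ _).trans (add_le_add ((T.le_opNorm x).trans ?_) hy)
    gcongr
  have h1 := (abs_le.1 (abs_real_inner_le_norm z (T x - y))).2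
  have h2 : ‖z‖ * ‖T x - y‖ ≤ B * (C * B + B) := by gcongr
  have h3 : 0 ≤ β / 2 * ‖T x - y‖ ^ 2 := by positivity
  unfold augLag
  linarith

variable [CompleteSpace E]

/-- The stationarity condition of the `x` update, rewritten through the multiplier update. -/
theorem adjoint_multiplier_eq {β : ℝ} {T T' : E →L[ℝ] E} {x' y' z z' gh gφ gφ' : E}
    (hst : gh - T.adjoint z + β • T'.adjoint (T' x' - y') + (gφ' - gφ) = 0)
    (hzup : z' = z - β • (T' x' - y')) :
    T'.adjoint z' = gh + gφ' - gφ + (T' - T).adjoint z := by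
  have h1 : (T' - T).adjoint z = T'.adjoint z - T.adjoint z := by
    rw [map_sub, sub_apply]
  rw [hzup, h1, map_sub, map_smul]
  rw [← sub_eq_zero, ← neg_zero, ← hst]
  module

/-- Subtracting the two multiplier identities cancels the newest operator increment `T₂ - T₁`,
leaving two gradient increments and `(T₁ - T₀).adjoint z₀`. The factor 3 from squaring three terms
against the lower bound `3/4 * σ` gives `4 / σ`, half of the 8 in the condition on `ρ`. -/
theorem multiplier_step {σ L₁ L₂ B C d₁ d₂ : ℝ} (hσ : 0 < σ) {T₀ T₁ T₂ : E →L[ℝ] E}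
    {z₀ z₁ z₂ φ₀ φ₁ φ₂ h₁ h₂ : E}
    (hT₂ : 3 / 4 * σ * ‖z₂ - z₁‖ ^ 2 ≤ ‖T₂.adjoint (z₂ - z₁)‖ ^ 2)
    (h1 : T₁.adjoint z₁ = h₁ + φ₁ - φ₀ + (T₁ - T₀).adjoint z₀)
    (h2 : T₂.adjoint z₂ = h₂ + φ₂ - φ₁ + (T₂ - T₁).adjoint z₁)
    (hz₀ : ‖z₀‖ ≤ B) (hC₀ : ‖T₀‖ ≤ C) (hC₁ : ‖T₁‖ ≤ C)
    (hL₁ : ‖(h₂ + φ₂) - (h₁ + φ₁)‖ ≤ L₁ * d₂) (hL₂ : ‖φ₁ - φ₀‖ ≤ L₂ * d₁) :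
    ‖z₂ - z₁‖ ^ 2 ≤ 4 / σ * (L₁ ^ 2 * d₂ ^ 2 + L₂ ^ 2 * d₁ ^ 2)
      + 4 / σ * (B ^ 2 * (2 * C)) * ‖T₁ - T₀‖ := by
  have hB : 0 ≤ B := (norm_nonneg _).trans hz₀
  have hid : T₂.adjoint (z₂ - z₁) = ((h₂ + φ₂) - (h₁ + φ₁)) - (φ₁ - φ₀) - (T₁ - T₀).adjoint z₀ := by
    have h3 : (T₂ - T₁).adjoint z₁ = T₂.adjoint z₁ - T₁.adjoint z₁ := by
      rw [map_sub, sub_apply]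
    rw [h3, h1] at h2
    rw [map_sub, h2]
    abel
  have hD : ‖(T₁ - T₀).adjoint z₀‖ ≤ ‖T₁ - T₀‖ * B := by
    refine ((T₁ - T₀).adjoint.le_opNorm z₀).trans ?_
    rw [LinearIsometryEquiv.norm_map]
    gcongr
  have hDC : ‖T₁ - T₀‖ ≤ 2 * C := (norm_sub_le _ _).trans (by linarith)
  have hle : ‖T₂.adjoint (z₂ - z₁)‖ ≤ L₁ * d₂ + L₂ * d₁ + ‖T₁ - T₀‖ * B := by
    rw [hid]
    exact (norm_sub_le _ _).trans (add_le_add ((norm_sub_le _ _).trans (add_le_add hL₁ hL₂)) hD)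
  have hsq : ‖T₂.adjoint (z₂ - z₁)‖ ^ 2
      ≤ 3 * ((L₁ * d₂) ^ 2 + (L₂ * d₁) ^ 2 + (‖T₁ - T₀‖ * B) ^ 2) :=
    (pow_le_pow_left₀ (norm_nonneg _) hle 2).trans (sq_add_add_le _ _ _)
  -- Only the first power of the increment is kept, since this is what is summable by assumption.
  have hq : (‖T₁ - T₀‖ * B) ^ 2 ≤ B ^ 2 * (2 * C) * ‖T₁ - T₀‖ := by
    have := mul_le_mul_of_nonneg_left hDC (norm_nonneg (T₁ - T₀))
    nlinarith [mul_le_mul_of_nonneg_left this (sq_nonneg B)]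
  have hfin : σ * ‖z₂ - z₁‖ ^ 2 ≤ 4 * ((L₁ ^ 2 * d₂ ^ 2 + L₂ ^ 2 * d₁ ^ 2)
      + B ^ 2 * (2 * C) * ‖T₁ - T₀‖) := by nlinarith
  have : 4 / σ * (L₁ ^ 2 * d₂ ^ 2 + L₂ ^ 2 * d₁ ^ 2) + 4 / σ * (B ^ 2 * (2 * C)) * ‖T₁ - T₀‖
      = 4 * ((L₁ ^ 2 * d₂ ^ 2 + L₂ ^ 2 * d₁ ^ 2) + B ^ 2 * (2 * C) * ‖T₁ - T₀‖) / σ := by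
    ring
  rw [this, le_div_iff₀ hσ]
  linarith

/-- Operators converging to one whose adjoint is bounded below are eventually bounded below,
uniformly. -/
theorem eventually_adjoint_bounded_below {σ : ℝ} (hσ : 0 < σ) {A : E →L[ℝ] E} {T : ℕ → E →L[ℝ] E}
    (hA : ∀ w, σ * ‖w‖ ^ 2 ≤ ‖A.adjoint w‖ ^ 2) (hT : Tendsto T atTop (𝓝 A)) :
    ∀ᶠ t in atTop, ∀ w, 3 / 4 * σ * ‖w‖ ^ 2 ≤ ‖(T t).adjoint w‖ ^ 2 := by
  -- A loss of one eighth is affordable: `(7/8)² = 49/64 ≥ 3/4`.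
  have hs : 0 < √σ / 8 := by positivity
  filter_upwards [Metric.tendsto_nhds.1 hT _ hs] with t ht w
  have h1 : √σ * ‖w‖ ≤ ‖A.adjoint w‖ := by
    refine le_of_sq_le_sq ?_ (norm_nonneg _)
    rw [mul_pow, Real.sq_sqrt hσ.le]
    exact hA w
  have h2 : ‖A.adjoint w - (T t).adjoint w‖ ≤ √σ / 8 * ‖w‖ := by
    rw [← sub_apply, ← map_sub]
    refine ((A - T t).adjoint.le_opNorm w).trans ?_
    rw [LinearIsometryEquiv.norm_map]
    gcongr
    rw [dist_eq_norm, norm_sub_rev] at ht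
    exact ht.le
  have h3 : 7 / 8 * (√σ * ‖w‖) ≤ ‖(T t).adjoint w‖ := by
    have := norm_sub_norm_le (A.adjoint w) ((T t).adjoint w)
    linarith
  have h4 := pow_le_pow_left₀ (by positivity) h3 2
  rw [mul_pow, mul_pow, Real.sq_sqrt hσ.le] at h4
  nlinarith [mul_nonneg hσ.le (sq_nonneg ‖w‖)]

/-- The iterates of the alternating scheme are asymptotically regular. -/
theorem tendsto_increments {β ρ σ L₁ L₂ B C m : ℝ} (hβ : 0 < β) (hσ : 0 < σ)
    (hρ : 8 / (β * σ) * (L₁ ^ 2 + L₂ ^ 2) < ρ)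
    {T : ℕ → E →L[ℝ] E} {x y z gh gφ : ℕ → E} {H p : ℕ → ℝ}
    (hx : ∀ t, ‖x t‖ ≤ B) (hy : ∀ t, ‖y t‖ ≤ B) (hz : ∀ t, ‖z t‖ ≤ B)
    (hT : ∀ t, ‖T t‖ ≤ C) (hTs : Summable fun t => ‖T (t + 1) - T t‖)
    (hTσ : ∀ t w, 3 / 4 * σ * ‖w‖ ^ 2 ≤ ‖(T t).adjoint w‖ ^ 2)
    (hm : ∀ t, m ≤ H t + p t)
    (hyup : ∀ t, p (t + 1) + (⟪z t, y (t + 1)⟫ + β / 2 * ‖T (t + 1) (x t) - y (t + 1)‖ ^ 2)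
      ≤ p t + (⟪z t, y t⟫ + β / 2 * ‖T (t + 1) (x t) - y t‖ ^ 2))
    (hxup : ∀ t, H (t + 1) - ⟪z t, T t (x (t + 1))⟫
        + β / 2 * ‖T (t + 1) (x (t + 1)) - y (t + 1)‖ ^ 2
      ≤ H t - ⟪z t, T t (x t)⟫ + β / 2 * ‖T (t + 1) (x t) - y (t + 1)‖ ^ 2
        - ρ / 2 * ‖x (t + 1) - x t‖ ^ 2)
    (hst : ∀ t, gh (t + 1) - (T t).adjoint (z t)
      + β • (T (t + 1)).adjoint (T (t + 1) (x (t + 1)) - y (t + 1)) + (gφ (t + 1) - gφ t) = 0)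
    (hzup : ∀ t, z (t + 1) = z t - β • (T (t + 1) (x (t + 1)) - y (t + 1)))
    (hL₁ : ∀ t, ‖(gh (t + 1) + gφ (t + 1)) - (gh t + gφ t)‖ ≤ L₁ * ‖x (t + 1) - x t‖)
    (hL₂ : ∀ t, ‖gφ (t + 1) - gφ t‖ ≤ L₂ * ‖x (t + 1) - x t‖) :
    Tendsto (fun t => ‖x (t + 1) - x t‖) atTop (𝓝 0) ∧
      Tendsto (fun t => ‖z (t + 1) - z t‖) atTop (𝓝 0) := by
  have hB : 0 ≤ B := (norm_nonneg _).trans (hx 0)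
  have hC : 0 ≤ C := (norm_nonneg _).trans (hT 0)
  have hstep := fun t => multiplier_step hσ (hTσ (t + 2) _)
    (adjoint_multiplier_eq (hst t) (hzup t)) (adjoint_multiplier_eq (hst (t + 1)) (hzup (t + 1)))
    (hz t) (hT t) (hT (t + 1)) (hL₁ (t + 1)) (hL₂ t)
  have hlag := fun t => augLag_step hβ (hx t) (hy t) (hz t) (hx (t + 1)) (hT t) (hT (t + 1))
    (hyup t) (hxup t) (hzup t)
  have hdsum : Summable fun t => ‖x (t + 1) - x t‖ ^ 2 :=
    summable_sq_of_lagrangian_descent (d := fun t => ‖x (t + 1) - x t‖)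
      (D := fun t => ‖T (t + 1) - T t‖) (s := fun t => ‖z (t + 1) - z t‖ ^ 2)
      (ℓ := fun t => augLag (H t + p t) β (T t) (x t) (y t) (z t)) (m := m - B * (C * B + B))
      hβ hσ hρ (by positivity) (by positivity) (fun t => norm_nonneg _) hTs
      (fun t => le_trans (by linarith [hm t])
        (augLag_lower_bound hβ (hx t) (hy t) (hz t) (hT t))) hlag hstep
  have hd0 : Tendsto (fun t => ‖x (t + 1) - x t‖ ^ 2) atTop (𝓝 0) := hdsum.tendsto_atTop_zero
  have hroot : ∀ u : ℕ → ℝ, (∀ t, 0 ≤ u t) → Tendsto (fun t => u t ^ 2) atTop (𝓝 0) →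
      Tendsto u atTop (𝓝 0) := fun u hu h => by
    have := (Real.continuous_sqrt.tendsto 0).comp h
    simpa [Function.comp_def, Real.sqrt_sq (hu _)] using this
  refine ⟨hroot _ (fun t => norm_nonneg _) hd0, ?_⟩
  refine hroot _ (fun t => norm_nonneg _) ((tendsto_add_atTop_iff_nat 1).1 ?_)
  refine squeeze_zero (fun t => sq_nonneg _) hstep ?_
  have h1 := (((((tendsto_add_atTop_iff_nat 1).2 hd0).const_mul (L₁ ^ 2)).add
    (hd0.const_mul (L₂ ^ 2))).const_mul (4 / σ)).add (hTs.tendsto_atTop_zero.const_mul (4 / σ * (B ^ 2 * (2 * C))))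
  simpa using h1

end ISAD

/-! ### Growth of the sample sizes. -/

namespace ISAD

section SampleSizes

variable {θ : ℕ → ℕ} {p : ℝ}

/-- Both regimes are powers with exponent `p > 1`, and the summability argument works uniformly in
such `p`. -/
theorem IsSamplingRegime.exists_exponent {n : ℕ} {π : Measure (Mat n)} {ε : ℝ} (hε : 0 < ε)
    (hθ : IsSamplingRegime π ε θ) :
    ∃ p : ℝ, 1 < p ∧ ∀ t : ℕ, |(θ t : ℝ) - (t : ℝ) ^ p| < 1 := by
  rcases hθ with ⟨-, h⟩ | h
  · exact ⟨1 + ε, by linarith, h⟩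
  · exact ⟨2 + ε, by linarith, h⟩

theorem sampleSize_zero (hp : 1 < p) (hθ : ∀ t : ℕ, |(θ t : ℝ) - (t : ℝ) ^ p| < 1) :
    θ 0 = 0 := by
  have h := (abs_lt.1 (hθ 0)).2
  rw [Nat.cast_zero, Real.zero_rpow (by linarith), sub_zero] at h
  exact Nat.lt_one_iff.1 (by exact_mod_cast h)

theorem sampleSize_le_succ (hp : 1 < p) (hθ : ∀ t : ℕ, |(θ t : ℝ) - (t : ℝ) ^ p| < 1) (t : ℕ) :
    θ t ≤ θ (t + 1) := by
  have h1 := (abs_lt.1 (hθ t)).2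
  have h2 := (abs_lt.1 (hθ (t + 1))).1
  have h3 := Real.add_rpow_le_rpow_add (Nat.cast_nonneg t) zero_le_one hp.le (a := (t : ℝ))
  push_cast at h2
  rw [Real.one_rpow] at h3
  have : (θ t : ℝ) < θ (t + 1) + 1 := by linarith
  exact Nat.lt_succ_iff.1 (by exact_mod_cast this)

theorem half_rpow_le_sampleSize (hθ : ∀ t : ℕ, |(θ t : ℝ) - (t : ℝ) ^ p| < 1) (hp : 1 < p) {t : ℕ}
    (ht : 1 ≤ t) : (t : ℝ) ^ p / 2 ≤ θ t := by
  have h1 := (abs_lt.1 (hθ t)).1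
  have h2 : (1 : ℝ) ≤ (t : ℝ) ^ p := Real.one_le_rpow (by exact_mod_cast ht) (by linarith)
  have h3 : (0 : ℝ) < θ t := by linarith
  have h4 : (1 : ℝ) ≤ θ t := by exact_mod_cast Nat.one_le_iff_ne_zero.2 (by rintro h; simp [h] at h3)
  linarith

theorem sampleSize_pos (hθ : ∀ t : ℕ, |(θ t : ℝ) - (t : ℝ) ^ p| < 1) (hp : 1 < p) {t : ℕ}
    (ht : 1 ≤ t) : 0 < θ t := by
  have h1 := half_rpow_le_sampleSize hθ hp ht
  have h2 : (0 : ℝ) < (t : ℝ) ^ p := Real.rpow_pos_of_pos (by exact_mod_cast ht) _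
  exact_mod_cast (show (0 : ℝ) < θ t by linarith)

theorem tendsto_sampleSize (hθ : ∀ t : ℕ, |(θ t : ℝ) - (t : ℝ) ^ p| < 1) (hp : 1 < p) :
    Tendsto θ atTop atTop := by
  rw [← tendsto_natCast_atTop_iff (R := ℝ)]
  refine tendsto_atTop_mono (f := fun t : ℕ => (t : ℝ) ^ p - 1) (fun t => ?_) ?_
  · linarith [(abs_lt.1 (hθ t)).1]
  · exact tendsto_atTop_add_const_right _ _
      ((tendsto_rpow_atTop (by linarith)).comp tendsto_natCast_atTop_atTop)

/-- With `s = t + 1`, Bernoulli gives `s ^ p - t ^ p ≤ p * s ^ (p - 1)`, and rounding adds at most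
2, whence `p + 2`. The denominators are at least `(s / 2) ^ p / 2` and `s ^ p / 2`, whence `4 * 2 ^
p` and the exponent `(p - 1) - 2 p`. -/
theorem inv_sampleSize_sub_le (hθ : ∀ t : ℕ, |(θ t : ℝ) - (t : ℝ) ^ p| < 1) (hp : 1 < p) {t : ℕ}
    (ht : 1 ≤ t) :
    1 / (θ t : ℝ) - 1 / (θ (t + 1) : ℝ) ≤ 4 * (p + 2) * 2 ^ p * ((t : ℝ) + 1) ^ (-(p + 1)) := by
  set s : ℝ := (t : ℝ) + 1 with hs
  have ht1 : (1 : ℝ) ≤ t := by exact_mod_cast ht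
  have hs0 : 0 < s := by positivity
  have hsp : 0 < s ^ p := Real.rpow_pos_of_pos hs0 _
  have htp : (t : ℝ) ^ p ≥ s ^ p * (1 - p / s) := by
    have h := one_add_mul_self_le_rpow_one_add (s := -1 / s) (p := p)
      (by rw [le_div_iff₀ hs0]; linarith) hp.le
    have e : (1 : ℝ) + -1 / s = t / s := by rw [hs]; field_simp; ring
    rw [e, Real.div_rpow (by positivity) hs0.le, le_div_iff₀ hsp] at h
    calc s ^ p * (1 - p / s) = (1 + p * (-1 / s)) * s ^ p := by ring
      _ ≤ _ := h
  have hsp1 : s ^ p = s ^ (p - 1) * s := by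
    rw [← Real.rpow_add_one hs0.ne']; ring_nf
  have hone : 1 ≤ s ^ (p - 1) := Real.one_le_rpow (by linarith) (by linarith)
  have hdiff : (θ (t + 1) : ℝ) - θ t ≤ (p + 2) * s ^ (p - 1) := by
    have h1 := (abs_lt.1 (hθ t)).1
    have h2 := (abs_lt.1 (hθ (t + 1))).2
    push_cast at h2
    have h3 : s ^ p * (1 - p / s) = s ^ p - p * s ^ (p - 1) := by
      rw [hsp1]; field_simp
    rw [← hs] at h2
    nlinarith
  have hlow : s ^ p * (1 / 2 ^ p) / 2 ≤ θ t := by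
    refine le_trans ?_ (half_rpow_le_sampleSize hθ hp ht)
    have : (s / 2) ^ p ≤ (t : ℝ) ^ p :=
      Real.rpow_le_rpow (by positivity) (by linarith) (by linarith)
    rw [Real.div_rpow hs0.le (by norm_num)] at this
    rw [mul_one_div]
    linarith
  have hlow' : s ^ p / 2 ≤ θ (t + 1) := by
    have := half_rpow_le_sampleSize hθ hp (t := t + 1) (by omega)
    push_cast at this
    exact this
  have h2p : (0 : ℝ) < 2 ^ p := by positivity
  have hθt : (0 : ℝ) < θ t := lt_of_lt_of_le (by positivity) hlow
  have hθt' : (0 : ℝ) < θ (t + 1) := lt_of_lt_of_le (by positivity) hlow'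
  have e1 : 1 / (θ t : ℝ) - 1 / (θ (t + 1) : ℝ) = ((θ (t + 1) : ℝ) - θ t) / (θ t * θ (t + 1)) := by
    field_simp
  have e2 : s ^ (-(p + 1)) = s ^ (p - 1) / (s ^ p * s ^ p) := by
    rw [← Real.rpow_add hs0, ← Real.rpow_sub hs0]; ring_nf
  rw [e1, e2]
  calc ((θ (t + 1) : ℝ) - θ t) / (θ t * θ (t + 1))
      ≤ ((p + 2) * s ^ (p - 1)) / ((s ^ p * (1 / 2 ^ p) / 2) * (s ^ p / 2)) := by
        have : 0 ≤ (p + 2) * s ^ (p - 1) := by positivity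
        gcongr
    _ = _ := by field_simp; ring

end SampleSizes

/-! ### Increments of scalar sample means. -/

section Averages

variable {Ω : Type*}

/-- The average of the first `k` terms of a sequence of random variables. -/
noncomputable def sampleMean (X : ℕ → Ω → ℝ) (k : ℕ) (ω : Ω) : ℝ :=
  (∑ i ∈ Finset.range k, X i ω) / k

/-- As a single weighted sum, the increment can be treated by independence: the weights sum to zero
(so the mean vanishes) and their squares sum to `1/k - 1/l`. -/
theorem sampleMean_sub_eq (X : ℕ → Ω → ℝ) {k l : ℕ} (hkl : k ≤ l) :
    (fun ω => sampleMean X l ω - sampleMean X k ω) =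
      ∑ i ∈ Finset.range l, fun ω => ((1 / l : ℝ) - if i < k then 1 / (k : ℝ) else 0) * X i ω := by
  ext ω
  have h : ∑ i ∈ Finset.range k, X i ω
      = ∑ i ∈ Finset.range l, if i < k then X i ω else 0 := by
    rw [← Finset.sum_filter]
    congr 1
    ext i
    simp
    omega
  rw [sampleMean, sampleMean, h, Finset.sum_apply, Finset.sum_div, Finset.sum_div,
    ← Finset.sum_sub_distrib]
  refine Finset.sum_congr rfl fun i _ => ?_
  split_ifs <;> ring

theorem sum_weights {k l : ℕ} (hk : 0 < k) (hkl : k ≤ l) :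
    ∑ i ∈ Finset.range l, ((1 / l : ℝ) - if i < k then 1 / (k : ℝ) else 0) = 0 := by
  have hl : (l : ℝ) ≠ 0 := by exact_mod_cast (hk.trans_le hkl).ne'
  have hk' : (k : ℝ) ≠ 0 := by positivity
  have hf : (Finset.range l).filter (· < k) = Finset.range k := by ext i; simp; omega
  rw [Finset.sum_sub_distrib, ← Finset.sum_filter, hf]
  simp [hl, hk']

theorem sum_weights_sq {k l : ℕ} (hk : 0 < k) (hkl : k ≤ l) :
    ∑ i ∈ Finset.range l, ((1 / l : ℝ) - if i < k then 1 / (k : ℝ) else 0) ^ 2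
      = 1 / k - 1 / l := by
  have hl : (l : ℝ) ≠ 0 := by exact_mod_cast (hk.trans_le hkl).ne'
  have hk' : (k : ℝ) ≠ 0 := by positivity
  have hf : (Finset.range l).filter (· < k) = Finset.range k := by ext i; simp; omega
  have e : ∀ i, ((1 / l : ℝ) - if i < k then 1 / (k : ℝ) else 0) ^ 2
      = (1 / l : ℝ) ^ 2 + if i < k then (1 / (k : ℝ)) ^ 2 - 2 / (l * k) else 0 := by
    intro i
    split_ifs <;> field_simp <;> ring
  simp_rw [e]
  rw [Finset.sum_add_distrib, ← Finset.sum_filter, hf]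
  simp
  field_simp
  ring

variable [MeasurableSpace Ω] {μ : Measure Ω} {X : ℕ → Ω → ℝ}

theorem memLp_sampleMean_sub (hX : ∀ i, MemLp (X i) 2 μ) {k l : ℕ} (hkl : k ≤ l) :
    MemLp (fun ω => sampleMean X l ω - sampleMean X k ω) 2 μ := by
  rw [sampleMean_sub_eq X hkl]
  exact memLp_finsetSum' _ fun i _ => (hX i).const_mul _

theorem eLpNorm_two_eq_sqrt {Y : Ω → ℝ} (hY : MemLp Y 2 μ) :
    eLpNorm Y 2 μ = ENNReal.ofReal (√(∫ ω, Y ω ^ 2 ∂μ)) := by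
  rw [hY.eLpNorm_eq_integral_rpow_norm two_ne_zero ENNReal.ofNat_ne_top]
  simp [Real.sqrt_eq_rpow]

variable [IsProbabilityMeasure μ]

theorem integral_sq_sampleMean_sub (hX : ∀ i, MemLp (X i) 2 μ)
    (hind : Pairwise fun i j => X i ⟂ᵢ[μ] X j) (hid : ∀ i, IdentDistrib (X i) (X 0) μ μ)
    {k l : ℕ} (hk : 0 < k) (hkl : k ≤ l) :
    ∫ ω, (sampleMean X l ω - sampleMean X k ω) ^ 2 ∂μ
      = (1 / (k : ℝ) - 1 / l) * Var[X 0; μ] := by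
  have hint : ∀ i, Integrable (X i) μ := fun i => (hX i).integrable one_le_two
  have hmean : ∫ ω, (sampleMean X l ω - sampleMean X k ω) ∂μ = 0 := by
    rw [sampleMean_sub_eq X hkl]
    refine (integral_congr_ae (ae_of_all _ fun ω => Finset.sum_apply ω _ _)).trans ?_
    rw [integral_finsetSum _ fun i _ => (hint i).const_mul _]
    simp_rw [integral_const_mul, fun i => (hid i).integral_eq]
    rw [← Finset.sum_mul, sum_weights hk hkl, zero_mul]
  rw [← variance_of_integral_eq_zero (memLp_sampleMean_sub hX hkl).aestronglyMeasurable.aemeasurable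
    hmean, sampleMean_sub_eq X hkl, IndepFun.variance_sum]
  · simp_rw [variance_const_mul, fun i => (hid i).variance_eq]
    rw [← Finset.sum_mul, sum_weights_sq hk hkl]
  · exact fun i _ => (hX i).const_mul _
  · exact fun i _ j _ hij => (hind hij).comp (measurable_const_mul _) (measurable_const_mul _)

/-- Along the sample sizes of the sampling regimes, the increments of the averages of square
integrable i.i.d. variables are almost surely absolutely summable. -/
theorem ae_summable_sampleMean_increments (hX : ∀ i, MemLp (X i) 2 μ)
    (hind : Pairwise fun i j => X i ⟂ᵢ[μ] X j) (hid : ∀ i, IdentDistrib (X i) (X 0) μ μ)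
    {θ : ℕ → ℕ} {p : ℝ} (hp : 1 < p) (hθ : ∀ t : ℕ, |(θ t : ℝ) - (t : ℝ) ^ p| < 1) :
    ∀ᵐ ω ∂μ, Summable fun t =>
      ‖sampleMean X (θ (t + 2)) ω - sampleMean X (θ (t + 1)) ω‖ := by
  have hmem := fun t => memLp_sampleMean_sub hX (sampleSize_le_succ hp hθ (t + 1))
  refine summable_norm_of_tsum_eLpNorm_ne_top one_le_two (fun t => (hmem t).1) ?_
  set c := 4 * (p + 2) * 2 ^ p * Var[X 0; μ] with hc
  have hbound : ∀ t, eLpNorm (fun ω => sampleMean X (θ (t + 2)) ω - sampleMean X (θ (t + 1)) ω) 2 μ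
      ≤ ENNReal.ofReal (√c * (((t + 2 : ℕ) : ℝ)) ^ (-((p + 1) / 2))) := by
    intro t
    rw [eLpNorm_two_eq_sqrt (hmem t), integral_sq_sampleMean_sub hX hind hid
      (sampleSize_pos hθ hp (by omega)) (sampleSize_le_succ hp hθ (t + 1))]
    refine ENNReal.ofReal_le_ofReal ?_
    have h1 := inv_sampleSize_sub_le hθ hp (t := t + 1) (by omega)
    have h2 := mul_le_mul_of_nonneg_right h1 (variance_nonneg (X 0) μ)
    have hpos : (0 : ℝ) ≤ ((t + 2 : ℕ) : ℝ) := by positivity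
    have h3 : 4 * (p + 2) * 2 ^ p * (((t + 1 : ℕ) : ℝ) + 1) ^ (-(p + 1)) * Var[X 0; μ]
        = c * (((t + 2 : ℕ) : ℝ) ^ (-((p + 1) / 2))) ^ 2 := by
      rw [← Real.rpow_natCast, ← Real.rpow_mul hpos, hc]
      push_cast
      ring_nf
    rw [h3] at h2
    refine (Real.sqrt_le_sqrt h2).trans (le_of_eq ?_)
    rw [Real.sqrt_mul' _ (sq_nonneg _), Real.sqrt_sq (Real.rpow_nonneg hpos _)]
  refine ne_top_of_le_ne_top ?_ (ENNReal.tsum_le_tsum hbound)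
  -- The exponent `(p + 1) / 2` exceeds 1 precisely because `p > 1`.
  have hs : Summable fun t : ℕ => √c * (((t + 2 : ℕ) : ℝ)) ^ (-((p + 1) / 2)) :=
    ((summable_nat_add_iff 2).2 (Real.summable_nat_rpow.2 (by linarith))).mul_left _
  exact hs.tsum_ofReal_ne_top

end Averages

/-! ### Convergence of the matrix averages. -/

section MatrixAverages

variable {n : ℕ}

theorem average_eq {θ : ℕ → ℕ} {p : ℝ} (hp : 1 < p)
    (hθ : ∀ t : ℕ, |(θ t : ℝ) - (t : ℝ) ^ p| < 1) {M Mbar : ℕ → Mat n}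
    (h : ∀ t, Mbar (t + 1) = ((θ t : ℝ) / (θ (t + 1) : ℝ)) • Mbar t
      + ((1 : ℝ) / (θ (t + 1) : ℝ)) • ∑ i ∈ Finset.Ico (θ t) (θ (t + 1)), M i) (t : ℕ) :
    Mbar (t + 1) = ((1 : ℝ) / (θ (t + 1) : ℝ)) • ∑ i ∈ Finset.range (θ (t + 1)), M i := by
  induction t with
  | zero =>
    -- As `θ 0 = 0`, the arbitrary matrix `Mbar 0` enters with weight zero.
    rw [h 0, sampleSize_zero hp hθ]
    simp
  | succ t ih =>
    have hpos : (θ (t + 1) : ℝ) ≠ 0 := by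
      exact_mod_cast (sampleSize_pos hθ hp (by omega)).ne'
    rw [h (t + 1), ih, smul_smul, ← Finset.sum_range_add_sum_Ico M (sampleSize_le_succ hp hθ (t + 1)),
      smul_add]
    congr 2
    field_simp

variable {Ω : Type*}

theorem average_apply {θ : ℕ → ℕ} {p : ℝ} (hp : 1 < p)
    (hθ : ∀ t : ℕ, |(θ t : ℝ) - (t : ℝ) ^ p| < 1) {M Mbar : ℕ → Ω → Mat n} {ω : Ω}
    (h : ∀ t, Mbar (t + 1) ω = ((θ t : ℝ) / (θ (t + 1) : ℝ)) • Mbar t ω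
      + ((1 : ℝ) / (θ (t + 1) : ℝ)) • ∑ i ∈ Finset.Ico (θ t) (θ (t + 1)), M i ω)
    (t : ℕ) (i j : Fin n) :
    Mbar (t + 1) ω i j = sampleMean (fun s ω => M s ω i j) (θ (t + 1)) ω := by
  rw [average_eq (M := fun i => M i ω) (Mbar := fun t => Mbar t ω) hp hθ h t, sampleMean,
    Matrix.smul_apply, Matrix.sum_apply, smul_eq_mul]
  ring

theorem measurable_entry (i j : Fin n) : Measurable fun A : Mat n => A i j :=
  (measurable_pi_apply j).comp (measurable_pi_apply (X := fun _ : Fin n => Fin n → ℝ) i)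

variable [MeasurableSpace Ω] {μ : Measure Ω} [IsProbabilityMeasure μ]

/-- Almost surely, the running averages converge to the mean, with absolutely summable
increments. -/
theorem ae_average_tendsto {π : Measure (Mat n)} [IsProbabilityMeasure π]
    (hvar : ∀ i j, MemLp (fun A : Mat n => A i j) 2 π)
    {θ : ℕ → ℕ} {p : ℝ} (hp : 1 < p) (hθ : ∀ t : ℕ, |(θ t : ℝ) - (t : ℝ) ^ p| < 1)
    {M : ℕ → Ω → Mat n} (hlaw : ∀ i, HasLaw (M i) π μ) (hindep : iIndepFun M μ)
    {Mbar : ℕ → Ω → Mat n}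
    (h : ∀ᵐ ω ∂μ, ∀ t, Mbar (t + 1) ω = ((θ t : ℝ) / (θ (t + 1) : ℝ)) • Mbar t ω
      + ((1 : ℝ) / (θ (t + 1) : ℝ)) • ∑ i ∈ Finset.Ico (θ t) (θ (t + 1)), M i ω) :
    ∀ᵐ ω ∂μ, Tendsto (fun t => toCLM (Mbar t ω)) atTop (𝓝 (toCLM (expMat π))) ∧
      Summable fun t => ‖toCLM (Mbar (t + 1) ω) - toCLM (Mbar t ω)‖ := by
  have hm := measurable_entry (n := n)
  have hid : ∀ i j s, IdentDistrib (fun ω => M s ω i j) (fun ω => M 0 ω i j) μ μ := fun i j s =>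
    ((hlaw s).identDistrib (hlaw 0)).comp (hm i j)
  have hL : ∀ i j s, MemLp (fun ω => M s ω i j) 2 μ := fun i j s =>
    MemLp.comp_of_map (g := fun A : Mat n => A i j) (by rw [(hlaw s).map_eq]; exact hvar i j)
      (hlaw s).aemeasurable
  have hind : ∀ i j, Pairwise fun s t => (fun ω => M s ω i j) ⟂ᵢ[μ] (fun ω => M t ω i j) :=
    fun i j s t hst => (hindep.indepFun hst).comp (hm i j) (hm i j)
  have hexp : ∀ i j, ∫ ω, M 0 ω i j ∂μ = expMat π i j := fun i j =>
    (hlaw 0).integral_comp (f := fun A : Mat n => A i j) (hm i j).aestronglyMeasurable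
  have hslln : ∀ᵐ ω ∂μ, ∀ i j, Tendsto (fun k => sampleMean (fun s ω => M s ω i j) k ω) atTop
      (𝓝 (expMat π i j)) := by
    simp_rw [ae_all_iff, ← hexp]
    exact fun i j => strong_law_ae_real _ ((hL i j 0).integrable one_le_two) (hind i j) (hid i j)
  have hsum : ∀ᵐ ω ∂μ, ∀ i j, Summable fun t =>
      ‖sampleMean (fun s ω => M s ω i j) (θ (t + 2)) ω
        - sampleMean (fun s ω => M s ω i j) (θ (t + 1)) ω‖ := by
    simp_rw [ae_all_iff]
    exact fun i j => ae_summable_sampleMean_increments (hL i j) (hind i j) (hid i j) hp hθ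
  filter_upwards [hslln, hsum, h] with ω h1 h2 h3
  constructor
  · refine (tendsto_add_atTop_iff_nat 1).1 ((continuous_toCLM.tendsto _).comp ?_)
    refine tendsto_pi_nhds.2 fun i => tendsto_pi_nhds.2 fun j => ?_
    have := (h1 i j).comp ((tendsto_add_atTop_iff_nat 1).2 (tendsto_sampleSize hθ hp))
    exact this.congr fun t => (average_apply hp hθ h3 t i j).symm
  · refine (summable_nat_add_iff 1).1 (Summable.of_nonneg_of_le (fun t => norm_nonneg _)
      (fun t => ?_) (summable_sum fun i (_ : i ∈ Finset.univ) =>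
        summable_sum fun j (_ : j ∈ Finset.univ) => h2 i j))
    rw [← toCLM_sub]
    refine (norm_toCLM_le _).trans (le_of_eq ?_)
    refine Finset.sum_congr rfl fun i _ => Finset.sum_congr rfl fun j _ => ?_
    rw [Matrix.sub_apply, average_apply hp hθ h3 (t + 1), average_apply hp hθ h3 t,
      Real.norm_eq_abs]

end MatrixAverages

end ISAD

namespace ISAD

variable {n : ℕ}

/-! ### The adjoint bound from the smallest eigenvalue. -/

section Spectral

theorem isUnit_of_rank_eq {A : Mat n} (hA : A.rank = n) : IsUnit A := by
  rw [← Matrix.mulVec_surjective_iff_isUnit]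
  have h1 : Module.finrank ℝ (LinearMap.range A.mulVecLin) = Module.finrank ℝ (Fin n → ℝ) := by
    rw [Module.finrank_fin_fun]
    exact hA
  have h2 := Submodule.eq_top_of_finrank_eq h1
  exact LinearMap.range_eq_top.1 h2

/-- The adjoint bound concerns `A Aᵀ`, while the eigenvalue is that of `Aᵀ A`. The two products have
the same nonzero spectrum, and `A Aᵀ` is invertible. `NeZero n` keeps the spectrum nonempty, so that
the infimum is attained. -/
theorem lambdaMin_pos_and_le [NeZero n] {A : Mat n} (hA : IsUnit A) :
    0 < lambdaMin (A.transpose * A) ∧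
      ∀ w, lambdaMin (A.transpose * A) * ‖w‖ ^ 2 ≤ ‖(toCLM A).adjoint w‖ ^ 2 := by
  set σ := lambdaMin (A.transpose * A) with hσ
  have hAT : IsUnit A.transpose := (Matrix.isUnit_transpose A).2 hA
  have hpd : (A.transpose * A).PosDef := by
    have := Matrix.PosDef.conjTranspose_mul_self A (Matrix.mulVec_injective_iff_isUnit.2 hA)
    rwa [Matrix.conjTranspose_eq_transpose_of_trivial] at this
  have hspec := hpd.isHermitian.spectrum_real_eq_range_eigenvalues
  have hmem : σ ∈ spectrum ℝ (A.transpose * A) := by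
    refine Set.Nonempty.csInf_mem ?_ ?_
    · rw [hspec]; exact Set.range_nonempty _
    · rw [hspec]; exact Set.finite_range _
  have hle : ∀ r ∈ spectrum ℝ (A.transpose * A), σ ≤ r := fun r hr =>
    csInf_le (by rw [hspec]; exact (Set.finite_range _).bddBelow) hr
  have hpos : 0 < σ := by
    rw [hspec] at hmem
    obtain ⟨i, hi⟩ := hmem
    rw [← hi]
    exact hpd.eigenvalues_pos i
  refine ⟨hpos, fun w => ?_⟩
  have hherm : (A * A.transpose).IsHermitian := by
    have := Matrix.isHermitian_mul_conjTranspose_self A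
    rwa [Matrix.conjTranspose_eq_transpose_of_trivial] at this
  have hsp : ∀ r ∈ spectrum ℝ (A * A.transpose), σ ≤ r := by
    intro r hr
    have hr0 : r ≠ 0 := by
      rintro rfl
      exact (spectrum.zero_notMem_iff ℝ).2 (hA.mul hAT) hr
    have : r ∈ spectrum ℝ (A.transpose * A) \ {0} := by
      rw [spectrum.nonzero_mul_comm]
      exact ⟨hr, hr0⟩
    exact hle r this.1
  have hpsd : (A * A.transpose - algebraMap ℝ (Mat n) σ).PosSemidef := by
    rw [Matrix.posSemidef_iff_isHermitian_and_spectrum_nonneg]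
    constructor
    · refine hherm.sub ?_
      rw [Algebra.algebraMap_eq_smul_one]
      exact Matrix.isHermitian_one.smul (IsSelfAdjoint.all σ)
    · rw [← spectrum.sub_singleton_eq]
      rintro _ ⟨r, hr, _, rfl, rfl⟩
      exact sub_nonneg.2 (hsp r hr)
  have h1 : 0 ≤ ⟪w, toCLM (A * A.transpose - algebraMap ℝ (Mat n) σ) w⟫ := by
    have := hpsd.dotProduct_mulVec_nonneg w.ofLp
    rw [toCLM, Matrix.inner_toEuclideanCLM]
    simpa using this
  rw [toCLM_sub, Algebra.algebraMap_eq_smul_one, toCLM_smul, toCLM_one, toCLM_mul,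
    sub_apply, inner_sub_right, ← adjoint_toCLM] at h1
  have h2 : ⟪w, (toCLM A).comp (toCLM A).adjoint w⟫ = ‖(toCLM A).adjoint w‖ ^ 2 := by
    rw [ContinuousLinearMap.comp_apply, ← ContinuousLinearMap.adjoint_inner_left,
      real_inner_self_eq_norm_sq]
  have h3 : ⟪w, (σ • ContinuousLinearMap.id ℝ (Vec n)) w⟫ = σ * ‖w‖ ^ 2 := by
    simp [inner_smul_right]
  rw [h2, h3] at h1
  linarith

end Spectral

/-! ### Subgradients produced by the `y` update. -/

section ProximalStep

variable {P : Vec n → EReal} {z v y : Vec n} {β : ℝ}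

theorem ne_top_of_mem_argmin (hP : IsProper P) {q : Vec n → ℝ}
    (hy : y ∈ argmin fun u => P u + (q u : EReal)) : P y ≠ ⊤ := by
  obtain ⟨u, hu⟩ := hP.2
  intro h
  have h1 : P y + (q y : EReal) ≤ P u + (q u : EReal) := hy u
  rw [h, EReal.top_add_coe, top_le_iff] at h1
  exact EReal.add_ne_top hu (EReal.coe_ne_top _) h1

theorem toReal_add_le_of_mem_argmin (hP : IsProper P) {q : Vec n → ℝ}
    (hy : y ∈ argmin fun u => P u + (q u : EReal)) {u : Vec n} (hu : P u ≠ ⊤) :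
    (P y).toReal + q y ≤ (P u).toReal + q u := by
  have h1 : P y + (q y : EReal) ≤ P u + (q u : EReal) := hy u
  rw [← EReal.coe_toReal (ne_top_of_mem_argmin hP hy) (hP.1 y), ← EReal.coe_toReal hu (hP.1 u)] at h1
  exact_mod_cast h1

/-- A minimizer of the proximal subproblem satisfies a global quadratic subgradient inequality. -/
theorem quadratic_subgradient (hP : IsProper P)
    (hy : y ∈ argmin fun u => P u + ((⟪z, u⟫ + β / 2 * ‖v - u‖ ^ 2 : ℝ) : EReal))
    {u : Vec n} (hu : P u ≠ ⊤) :
    (P y).toReal + ⟪-z + β • (v - y), u - y⟫ - β / 2 * ‖u - y‖ ^ 2 ≤ (P u).toReal := by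
  have h1 := toReal_add_le_of_mem_argmin hP (q := fun u => ⟪z, u⟫ + β / 2 * ‖v - u‖ ^ 2) hy hu
  have h2 : ‖v - u‖ ^ 2 = ‖v - y‖ ^ 2 - 2 * ⟪v - y, u - y⟫ + ‖u - y‖ ^ 2 := by
    rw [← norm_sub_sq_real]
    congr 2
    abel
  have h3 : ⟪-z + β • (v - y), u - y⟫ = ⟪z, y⟫ - ⟪z, u⟫ + β * ⟪v - y, u - y⟫ := by
    rw [inner_add_left, inner_neg_left, real_inner_smul_left, inner_sub_right z]
    ring
  rw [h2] at h1
  rw [h3]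
  linarith

end ProximalStep

/-- A quadratic minorant of `P` pulls back along `A` to one whose defect is `O(‖w - x‖²)`. Half of
`η` absorbs this defect, the other half the first-order remainder of `h`. -/
theorem isRegularSubgradient_add_comp {h : Vec n → ℝ} {P : Vec n → EReal} (hP : IsProper P)
    {A : Vec n →L[ℝ] Vec n} {g v x : Vec n} {β : ℝ} (hh : HasGradientAt h g x) (hx : P (A x) ≠ ⊤)
    (hv : ∀ u, P u ≠ ⊤ → (P (A x)).toReal + ⟪v, u - A x⟫ - β / 2 * ‖u - A x‖ ^ 2 ≤ (P u).toReal)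
    (hβ : 0 ≤ β) :
    IsRegularSubgradient (fun u => (h u : EReal) + P (A u)) x (g + A.adjoint v) := by
  refine ⟨EReal.add_ne_top (EReal.coe_ne_top _) hx, ?_, fun η hη => ?_⟩
  · exact EReal.add_ne_bot_iff.2 ⟨EReal.coe_ne_bot _, hP.1 _⟩
  have hsmall : ∀ᶠ w in 𝓝 x, β / 2 * ‖A‖ ^ 2 * ‖w - x‖ < η / 2 := by
    have hc : Continuous fun w : Vec n => β / 2 * ‖A‖ ^ 2 * ‖w - x‖ := by fun_prop
    have ht := hc.tendsto x
    simp only [sub_self, norm_zero, mul_zero] at ht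
    exact ht.eventually (gt_mem_nhds (half_pos hη))
  filter_upwards [hsmall, HasGradientAt.eventually_abs_sub_le hh (half_pos hη)] with w hw1 hw2
  by_cases hw : P (A w) = ⊤
  · rw [hw, EReal.coe_add_top]
    exact le_top
  rw [← EReal.coe_toReal hx (hP.1 _), ← EReal.coe_toReal hw (hP.1 _)]
  have h1 := hv _ hw
  have h2 := (abs_le.1 hw2).1
  have h3 : ‖A w - A x‖ ^ 2 ≤ ‖A‖ ^ 2 * ‖w - x‖ * ‖w - x‖ := by
    rw [← map_sub]
    calc ‖A (w - x)‖ ^ 2 ≤ (‖A‖ * ‖w - x‖) ^ 2 := by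
          gcongr
          exact A.le_opNorm _
      _ = _ := by ring
  have h4 := mul_le_mul_of_nonneg_left h3 (div_nonneg hβ zero_le_two)
  have h5 := mul_le_mul_of_nonneg_right hw1.le (norm_nonneg (w - x))
  have h6 : ⟪A.adjoint v, w - x⟫ = ⟪v, A w - A x⟫ := by
    rw [ContinuousLinearMap.adjoint_inner_left, map_sub]
  have h7 : h x + (P (A x)).toReal + (⟪g + A.adjoint v, w - x⟫ - η * ‖w - x‖)
      ≤ h w + (P (A w)).toReal := by
    rw [inner_add_left, h6]
    linarith
  exact_mod_cast h7

/-! ### Passing to the limit in the optimality conditions. -/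

section Limit

theorem tendsto_clm_apply {E : Type*} [NormedAddCommGroup E] [NormedSpace ℝ E]
    {T : ℕ → E →L[ℝ] E} {A : E →L[ℝ] E} {u : ℕ → E} {v : E} (hT : Tendsto T atTop (𝓝 A))
    (hu : Tendsto u atTop (𝓝 v)) : Tendsto (fun k => T k (u k)) atTop (𝓝 (A v)) :=
  (isBoundedBilinearMap_apply (𝕜 := ℝ) (E := E) (F := E)).continuous.continuousAt.tendsto.comp
    (hT.prodMk_nhds hu)

/-- Along a convergent sequence of proximal steps the function values converge. -/
theorem tendsto_toReal_of_mem_argmin {P : Vec n → EReal} (hP : IsProper P)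
    (hlsc : LowerSemicontinuous P) {b : ℝ} {v y z : ℕ → Vec n} {vs ys zs : Vec n}
    (hv : Tendsto v atTop (𝓝 vs)) (hy : Tendsto y atTop (𝓝 ys)) (hz : Tendsto z atTop (𝓝 zs))
    (hmin : ∀ k, y k ∈ argmin fun u => P u + ((⟪z k, u⟫ + b / 2 * ‖v k - u‖ ^ 2 : ℝ) : EReal)) :
    P ys ≠ ⊤ ∧ Tendsto (fun k => (P (y k)).toReal) atTop (𝓝 (P ys).toReal) := by
  have hne : ∀ k, P (y k) ≠ ⊤ := fun k => ne_top_of_mem_argmin hP (hmin k)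
  have hup : ∀ u, P u ≠ ⊤ → ∀ k, (P (y k)).toReal ≤ (P u).toReal
      + (⟪z k, u⟫ + b / 2 * ‖v k - u‖ ^ 2) - (⟪z k, y k⟫ + b / 2 * ‖v k - y k‖ ^ 2) := by
    intro u hu k
    have := toReal_add_le_of_mem_argmin hP
      (q := fun u => ⟪z k, u⟫ + b / 2 * ‖v k - u‖ ^ 2) (hmin k) hu
    linarith
  have hlim : ∀ u, Tendsto (fun k => (P u).toReal
      + (⟪z k, u⟫ + b / 2 * ‖v k - u‖ ^ 2) - (⟪z k, y k⟫ + b / 2 * ‖v k - y k‖ ^ 2)) atTop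
      (𝓝 ((P u).toReal + (⟪zs, u⟫ + b / 2 * ‖vs - u‖ ^ 2)
        - (⟪zs, ys⟫ + b / 2 * ‖vs - ys‖ ^ 2))) := fun u =>
    (((hz.inner tendsto_const_nhds).add (((hv.sub_const u).norm.pow 2).const_mul _)).const_add
      _).sub ((hz.inner hy).add (((hv.sub hy).norm.pow 2).const_mul _))
  have hlow : ∀ a : ℝ, (a : EReal) < P ys → ∀ᶠ k in atTop, a < (P (y k)).toReal := by
    intro a ha
    filter_upwards [hy.eventually (hlsc ys a ha)] with k hk
    rw [← EReal.coe_toReal (hne k) (hP.1 _)] at hk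
    exact_mod_cast hk
  -- Comparison with one point where `P` is finite bounds the values `P (y k)` from above, whereas
  -- `P ys = ⊤` would make them unbounded by lower semicontinuity.
  have htop : P ys ≠ ⊤ := by
    intro htop
    obtain ⟨u, hu⟩ := hP.2
    have h1 := (hlim u).eventually (gt_mem_nhds (lt_add_one _))
    obtain ⟨k, hk1, hk2⟩ := (h1.and (hlow _ (htop ▸ EReal.coe_lt_top
      ((P u).toReal + (⟪zs, u⟫ + b / 2 * ‖vs - u‖ ^ 2)
        - (⟪zs, ys⟫ + b / 2 * ‖vs - ys‖ ^ 2) + 1)))).exists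
    linarith [hup u hu k]
  refine ⟨htop, tendsto_order.2 ⟨fun a ha => hlow a ?_, fun a ha => ?_⟩⟩
  · rw [← EReal.coe_toReal htop (hP.1 _)]
    exact_mod_cast ha
  -- Testing minimality against `ys` itself makes the quadratic terms cancel in the limit.
  · have h1 := hlim ys
    rw [add_sub_cancel_right] at h1
    filter_upwards [h1.eventually (gt_mem_nhds ha)] with k hk
    exact (hup ys htop k).trans_lt hk

/-- The limit of a convergent sequence of asymptotically regular iterations is critical. -/
theorem mem_crit_of_tendsto {h φ : Vec n → ℝ} (hh : ContDiff ℝ 2 h) (hφ : ContDiff ℝ 2 φ)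
    {P : Vec n → EReal} (hP : IsProper P) (hlsc : LowerSemicontinuous P) {A : Mat n}
    (hA : IsUnit A) {b : ℝ} (hb : 0 < b) {A₀ A₁ : ℕ → Mat n} {x₀ x₁ y₁ z₀ z₁ : ℕ → Vec n}
    {xs ys zs : Vec n}
    (hA₀ : Tendsto (fun k => toCLM (A₀ k)) atTop (𝓝 (toCLM A)))
    (hA₁ : Tendsto (fun k => toCLM (A₁ k)) atTop (𝓝 (toCLM A)))
    (hx₀ : Tendsto x₀ atTop (𝓝 xs)) (hx₁ : Tendsto x₁ atTop (𝓝 xs))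
    (hy₁ : Tendsto y₁ atTop (𝓝 ys))
    (hz₀ : Tendsto z₀ atTop (𝓝 zs)) (hz₁ : Tendsto z₁ atTop (𝓝 zs))
    (hyup : ∀ k, y₁ k ∈ argmin fun v =>
      P v + ((⟪z₀ k, v⟫ + b / 2 * ‖toCLM (A₁ k) (x₀ k) - v‖ ^ 2 : ℝ) : EReal))
    (hxup : ∀ k, x₁ k ∈ crit fun u =>
      ((gFun h φ (A₀ k) (A₁ k) b (z₀ k) (y₁ k) (x₀ k) u : ℝ) : EReal))
    (hzup : ∀ k, z₁ k = z₀ k - b • (toCLM (A₁ k) (x₁ k) - y₁ k)) :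
    xs ∈ crit fun u => (h u : EReal) + P (toCLM A u) := by
  have hgh := (contDiff_gradient hh).continuous
  have hgφ := (contDiff_gradient hφ).continuous
  have hadj : Continuous fun T : Vec n →L[ℝ] Vec n => T.adjoint :=
    (ContinuousLinearMap.adjoint (𝕜 := ℝ) (E := Vec n) (F := Vec n)).continuous
  -- feasibility of the limit
  have hres : Tendsto (fun k => toCLM (A₁ k) (x₁ k) - y₁ k) atTop (𝓝 (toCLM A xs - ys)) :=
    (tendsto_clm_apply hA₁ hx₁).sub hy₁
  have hfeas : toCLM A xs - ys = 0 := by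
    have h1 : Tendsto (fun k => b⁻¹ • (z₀ k - z₁ k)) atTop (𝓝 (b⁻¹ • (zs - zs))) :=
      (hz₀.sub hz₁).const_smul _
    rw [sub_self, smul_zero] at h1
    refine tendsto_nhds_unique hres (h1.congr fun k => ?_)
    rw [hzup k, sub_sub_cancel, smul_smul, inv_mul_cancel₀ hb.ne', one_smul]
  have hys : toCLM A xs = ys := sub_eq_zero.1 hfeas
  -- stationarity of the limit
  have hstat : ∇ h xs - (toCLM A).adjoint zs = 0 := by
    have h1 : Tendsto (fun k => ∇ h (x₁ k) - (toCLM (A₀ k)).adjoint (z₀ k)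
        + b • (toCLM (A₁ k)).adjoint (toCLM (A₁ k) (x₁ k) - y₁ k)
        + (∇ φ (x₁ k) - ∇ φ (x₀ k))) atTop
        (𝓝 (∇ h xs - (toCLM A).adjoint zs + b • (toCLM A).adjoint (toCLM A xs - ys)
          + (∇ φ xs - ∇ φ xs))) :=
      ((((hgh.tendsto _).comp hx₁).sub (tendsto_clm_apply ((hadj.tendsto _).comp hA₀) hz₀)).add
        ((tendsto_clm_apply ((hadj.tendsto _).comp hA₁) hres).const_smul b)).add
        (((hgφ.tendsto _).comp hx₁).sub ((hgφ.tendsto _).comp hx₀))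
    rw [hfeas, map_zero, smul_zero, sub_self, add_zero, add_zero] at h1
    refine tendsto_nhds_unique h1 ?_
    simp_rw [fun k => gFun_stationarity hh hφ (hxup k)]
    exact tendsto_const_nhds
  obtain ⟨htop, hval⟩ := tendsto_toReal_of_mem_argmin hP hlsc (tendsto_clm_apply hA₁ hx₀) hy₁ hz₀ hyup
  -- the regular subgradients at the preimages of the points `y₁ k`
  have hdet : IsUnit A.det := (Matrix.isUnit_iff_isUnit_det A).1 hA
  have hinv : ∀ u, toCLM A (toCLM A⁻¹ u) = u := fun u => by
    rw [← ContinuousLinearMap.comp_apply, ← toCLM_mul, Matrix.mul_nonsing_inv A hdet, toCLM_one]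
    rfl
  have hinv' : ∀ u, toCLM A⁻¹ (toCLM A u) = u := fun u => by
    rw [← ContinuousLinearMap.comp_apply, ← toCLM_mul, Matrix.nonsing_inv_mul A hdet, toCLM_one]
    rfl
  have hu : Tendsto (fun k => toCLM A⁻¹ (y₁ k)) atTop (𝓝 xs) := by
    have h1 := ((toCLM A⁻¹).continuous.tendsto ys).comp hy₁
    rwa [← hys, hinv'] at h1
  have hne : ∀ k, P (y₁ k) ≠ ⊤ := fun k => ne_top_of_mem_argmin hP (hyup k)
  rw [← hys] at htop hval
  -- The approximating points are the preimages of `y₁ k` rather than `x₁ k`: minimality gives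
  -- finiteness and a subgradient of `P` at `y₁ k`, but nothing at `A (x₁ k)`.
  refine ⟨EReal.add_ne_top (EReal.coe_ne_top _) htop,
    EReal.add_ne_bot_iff.2 ⟨EReal.coe_ne_bot _, hP.1 _⟩, fun k => toCLM A⁻¹ (y₁ k),
    fun k => ∇ h (toCLM A⁻¹ (y₁ k))
      + (toCLM A).adjoint (-z₀ k + b • (toCLM (A₁ k) (x₀ k) - y₁ k)), hu, ?_, ?_, fun k => ?_⟩
  · simp only [hinv]
    rw [← EReal.coe_toReal htop (hP.1 _), ← EReal.coe_add]
    have h1 := EReal.tendsto_coe.2 (((hh.continuous.tendsto xs).comp hu).add hval)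
    refine h1.congr fun k => ?_
    rw [EReal.coe_add, EReal.coe_toReal (hne k) (hP.1 _)]
    rfl
  · have h1 : Tendsto (fun k => ∇ h (toCLM A⁻¹ (y₁ k))
        + (toCLM A).adjoint (-z₀ k + b • (toCLM (A₁ k) (x₀ k) - y₁ k))) atTop
        (𝓝 (∇ h xs + (toCLM A).adjoint (-zs + b • (toCLM A xs - ys)))) :=
      ((hgh.tendsto _).comp hu).add (((toCLM A).adjoint.continuous.tendsto _).comp
        (hz₀.neg.add (((tendsto_clm_apply hA₁ hx₀).sub hy₁).const_smul b)))
    rwa [hfeas, smul_zero, add_zero, map_neg, ← sub_eq_add_neg, hstat] at h1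
  · refine isRegularSubgradient_add_comp hP (β := b) (hasGradientAt_of_contDiff hh _) ?_
      (fun u hu => ?_) hb.le
    · rw [hinv]; exact hne k
    · rw [hinv]; exact quadratic_subgradient hP (hyup k) hu

end Limit

/-! ### Cluster points of a single run. -/

section Run

variable {h φ : Vec n → ℝ} {P : Vec n → EReal}

/-- The data terms are bounded below on bounded sets. -/
theorem exists_lower_bound (hh : ContDiff ℝ 2 h) (hP : IsProper P) (hlsc : LowerSemicontinuous P)
    {B : ℝ} (hB : 0 ≤ B) :
    ∃ m : ℝ, ∀ x y, ‖x‖ ≤ B → ‖y‖ ≤ B → P y ≠ ⊤ → m ≤ h x + (P y).toReal := by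
  have hne : (Metric.closedBall (0 : Vec n) B).Nonempty := ⟨0, by simpa using hB⟩
  obtain ⟨a, -, ha⟩ := (isCompact_closedBall (0 : Vec n) B).exists_isMinOn hne
    hh.continuous.continuousOn
  obtain ⟨c, -, hc⟩ := LowerSemicontinuousOn.exists_isMinOn hne
    (isCompact_closedBall (0 : Vec n) B) (hlsc.lowerSemicontinuousOn _)
  refine ⟨h a + (P c).toReal, fun x y hx hy hy' => add_le_add (ha (by simpa using hx)) ?_⟩
  exact EReal.toReal_le_toReal (hc (by simpa using hy)) (hP.1 _) hy'

/-- The guaranteed decrease of the `x` subproblem without its Bregman term. -/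
theorem decrease_of_gFun_sub_le (hφ : ContDiff ℝ 2 φ) (hc : ConvexOn ℝ Set.univ φ) {A A' : Mat n}
    {β r : ℝ} {z y x x' : Vec n} (hg : gFun h φ A A' β z y x x' - gFun h φ A A' β z y x x ≤ r) :
    h x' - ⟪z, toCLM A x'⟫ + β / 2 * ‖toCLM A' x' - y‖ ^ 2
      ≤ h x - ⟪z, toCLM A x⟫ + β / 2 * ‖toCLM A' x - y‖ ^ 2 + r := by
  have h1 := bregman_nonneg hφ hc x' x
  have h2 : bregman φ x x = 0 := by simp [bregman]
  simp only [gFun, toEuclideanLin_eq_toCLM, h2] at hg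
  linarith

/-- Deterministic convergence: along a run of the algorithm whose averages converge to an invertible
matrix with summable increments, cluster points are critical. -/
theorem IsRun.mem_crit [NeZero n] {θ : ℕ → ℕ} {M Mbar : ℕ → Mat n} {x y z : ℕ → Vec n} {β : ℕ → ℝ}
    (hrun : IsRun h φ P θ M Mbar x y z β) (hh : ContDiff ℝ 2 h) (hφ : ContDiff ℝ 2 φ)
    (hc : ConvexOn ℝ Set.univ φ) (hP : IsProper P) (hlsc : LowerSemicontinuous P)
    {A : Mat n} (hA : IsUnit A) (hbdd : BoundedIterates x y z)
    (hAPO : SatisfiesAPO h φ (lambdaMin (A.transpose * A)) Mbar x y z β)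
    (hlim : Tendsto (fun t => toCLM (Mbar t)) atTop (𝓝 (toCLM A)))
    (hsum : Summable fun t => ‖toCLM (Mbar (t + 1)) - toCLM (Mbar t)‖)
    {xs ys zs : Vec n} (hcl : MapClusterPt (xs, ys, zs) atTop fun t => (x t, y t, z t)) :
    xs ∈ crit fun u => (h u : EReal) + P (toCLM A u) := by
  obtain ⟨hσ, hAσ⟩ := lambdaMin_pos_and_le hA
  set σ := lambdaMin (A.transpose * A)
  obtain ⟨K, hK, hβK, ρ, -, hρ⟩ := hAPO
  obtain ⟨B, hB⟩ := hbdd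
  have hB0 : 0 ≤ B := (norm_nonneg _).trans (hB 1 one_pos).1
  set b := β K with hb
  have hbpos : 0 < b := hrun.penalty_pos K
  -- The empirical Lipschitz constants include the step from `x 0`, which the bound `B` does not
  -- cover.
  have hxall : ∀ t, ‖x t‖ ≤ max B ‖x 0‖ := fun t => by
    rcases Nat.eq_zero_or_pos t with rfl | ht
    · exact le_max_right _ _
    · exact ((hB t ht).1).trans (le_max_left _ _)
  obtain ⟨C, hC⟩ := hlim.norm.bddAbove_range
  obtain ⟨N₀, hN₀⟩ := eventually_atTop.1 (eventually_adjoint_bounded_below hσ hAσ hlim)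
  -- From `N` on, the penalty is constant, the adjoints are bounded below, and every `y` comes from
  -- an update, so that `P` is finite there.
  obtain ⟨N, hNK, hNN⟩ : ∃ N, K < N ∧ N₀ ≤ N := ⟨max (K + 1) N₀, by omega, by omega⟩
  have hNt : ∀ t, β (N + t) = b := fun t => hβK _ (by omega)
  have hyne : ∀ t, P (y (t + 1)) ≠ ⊤ := fun t => ne_top_of_mem_argmin hP (hrun.y_update t)
  have hyne' : ∀ t, P (y (N + t)) ≠ ⊤ := fun t => by
    obtain ⟨s, hs⟩ : ∃ s, N + t = s + 1 := ⟨N + t - 1, by omega⟩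
    rw [hs]
    exact hyne s
  have hyup : ∀ t, y (N + t + 1) ∈ argmin fun v => P v + ((⟪z (N + t), v⟫
      + b / 2 * ‖toCLM (Mbar (N + t + 1)) (x (N + t)) - v‖ ^ 2 : ℝ) : EReal) := fun t => by
    have := hrun.y_update (N + t)
    rwa [hNt] at this
  have hxup : ∀ t, x (N + t + 1) ∈ crit fun u => ((gFun h φ (Mbar (N + t)) (Mbar (N + t + 1)) b
      (z (N + t)) (y (N + t + 1)) (x (N + t)) u : ℝ) : EReal) := fun t => by
    have := hrun.x_update (N + t)
    rwa [hNt] at this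
  have hzup : ∀ t, z (N + t + 1) = z (N + t)
      - b • (toCLM (Mbar (N + t + 1)) (x (N + t + 1)) - y (N + t + 1)) := fun t => by
    have := hrun.z_update (N + t)
    rwa [hNt] at this
  obtain ⟨m, hm⟩ := exists_lower_bound hh hP hlsc hB0
  have hρN := (hρ N hNK).2
  rw [show β N = b from hNt 0] at hρN
  have hshift : ∀ {f : ℕ → ℝ}, Summable f → Summable fun t => f (N + t) := fun {f} hf => by
    simpa [add_comm] using (summable_nat_add_iff N).2 hf
  have hgF : ContDiff ℝ 1 fun u => ∇ h u + ∇ φ u := (contDiff_gradient hh).add (contDiff_gradient hφ)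
  obtain ⟨hdx, hdz⟩ := tendsto_increments (B := B) (C := C) (m := m) hbpos hσ hρN
    (T := fun t => toCLM (Mbar (N + t)))
    (x := fun t => x (N + t)) (y := fun t => y (N + t)) (z := fun t => z (N + t))
    (gh := fun t => ∇ h (x (N + t))) (gφ := fun t => ∇ φ (x (N + t)))
    (H := fun t => h (x (N + t))) (p := fun t => (P (y (N + t))).toReal)
    (fun t => (hB (N + t) (by omega)).1) (fun t => (hB (N + t) (by omega)).2.1)
    (fun t => (hB (N + t) (by omega)).2.2)
    (fun t => hC ⟨N + t, rfl⟩) (hshift hsum)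
    (fun t w => hN₀ (N + t) (by omega) w)
    (fun t => hm _ _ (hB (N + t) (by omega)).1 (hB (N + t) (by omega)).2.1 (hyne' t))
    (fun t => toReal_add_le_of_mem_argmin hP (q := fun v => ⟪z (N + t), v⟫
      + b / 2 * ‖toCLM (Mbar (N + t + 1)) (x (N + t)) - v‖ ^ 2) (hyup t) (hyne' t))
    (fun t => by
      have h1 := (hρ (N + t) (by omega)).1
      rw [hNt] at h1
      have h2 := decrease_of_gFun_sub_le hφ hc h1
      simp only [← add_assoc]
      linarith)
    (fun t => gFun_stationarity hh hφ (hxup t)) hzup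
    (fun t => eLip_spec hgF hxall (N + t))
    (fun t => eLip_spec (contDiff_gradient hφ) hxall (N + t))
  obtain ⟨ψ, hψ, hconv⟩ := hcl.tendsto_subseq
  -- The cluster subsequence is reindexed to consist of outputs of rounds after `N`; since `ψ m ≥
  -- m`, the natural subtractions do not truncate.
  have hψN : ∀ k, N + (ψ (k + N + 1) - N - 1) + 1 = ψ (k + N + 1) := fun k => by
    have := hψ.le_apply (x := k + N + 1)
    omega
  set s : ℕ → ℕ := fun k => ψ (k + N + 1) - N - 1 with hs
  have hstend : Tendsto s atTop atTop := tendsto_atTop_mono (fun k => by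
    have := hψ.le_apply (x := k + N + 1)
    change k ≤ ψ (k + N + 1) - N - 1
    omega) tendsto_id
  have hconv' := hconv.comp (tendsto_add_atTop_nat (N + 1))
  have hconv'' : Tendsto (fun k => (x (N + s k + 1), y (N + s k + 1), z (N + s k + 1))) atTop
      (𝓝 (xs, ys, zs)) := hconv'.congr fun k => by
    simp only [Function.comp, ← add_assoc, hs, hψN]
  have hx₁ : Tendsto (fun k => x (N + s k + 1)) atTop (𝓝 xs) := hconv''.fst_nhds
  have hy₁ : Tendsto (fun k => y (N + s k + 1)) atTop (𝓝 ys) := hconv''.snd_nhds.fst_nhds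
  have hz₁ : Tendsto (fun k => z (N + s k + 1)) atTop (𝓝 zs) := hconv''.snd_nhds.snd_nhds
  have hx₀ : Tendsto (fun k => x (N + s k)) atTop (𝓝 xs) := by
    have h1 := hx₁.sub (tendsto_zero_iff_norm_tendsto_zero.2 (hdx.comp hstend))
    rw [sub_zero] at h1
    exact h1.congr fun k => sub_sub_cancel _ _
  have hz₀ : Tendsto (fun k => z (N + s k)) atTop (𝓝 zs) := by
    have h1 := hz₁.sub (tendsto_zero_iff_norm_tendsto_zero.2 (hdz.comp hstend))
    rw [sub_zero] at h1
    exact h1.congr fun k => sub_sub_cancel _ _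
  have hN1 : Tendsto (fun k => N + s k) atTop atTop := tendsto_atTop_mono (fun k => by omega) hstend
  exact mem_crit_of_tendsto hh hφ hP hlsc hA hbpos (hlim.comp hN1)
    (hlim.comp ((tendsto_add_atTop_nat 1).comp hN1)) hx₀ hx₁ hy₁ hz₀ hz₁
    (fun k => hyup (s k)) (fun k => hxup (s k)) (fun k => hzup (s k))

end Run

end ISAD

/-! ### Assembly. -/

theorem mainTheorem1 {n : ℕ} {Ω : Type*} [MeasurableSpace Ω]
    (μ : Measure Ω) [IsProbabilityMeasure μ]
    -- the distribution of the random matrix: full-rank mean, finite variance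
    (π : Measure (ISAD.Mat n)) [IsProbabilityMeasure π]
    (hvar : ∀ i j, MemLp (fun A : ISAD.Mat n => A i j) 2 π)
    (hrank : (ISAD.expMat π).rank = n)
    -- the data of the problem and of the algorithm
    (h : ISAD.Vec n → ℝ) (hh : ContDiff ℝ 2 h)
    (P : ISAD.Vec n → EReal) (hPproper : ISAD.IsProper P) (hPlsc : LowerSemicontinuous P)
    (φ : ISAD.Vec n → ℝ) (hφ : ContDiff ℝ 2 φ) (hφconvex : ConvexOn ℝ Set.univ φ)
    (ε : ℝ) (hε : 0 < ε) (θ : ℕ → ℕ) (hθ : ISAD.IsSamplingRegime π ε θ)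
    -- the i.i.d. samples
    (M : ℕ → Ω → ISAD.Mat n) (hlaw : ∀ i, HasLaw (M i) π μ) (hindep : iIndepFun M μ)
    -- the processes generated by the algorithm
    (Mbar : ℕ → Ω → ISAD.Mat n) (x y z : ℕ → Ω → ISAD.Vec n) (β : ℕ → Ω → ℝ)
    (hrun : ∀ᵐ ω ∂μ, ISAD.IsRun h φ P θ (fun i => M i ω) (fun t => Mbar t ω)
      (fun t => x t ω) (fun t => y t ω) (fun t => z t ω) (fun t => β t ω))
    (hbdd : ∀ᵐ ω ∂μ, ISAD.BoundedIterates (fun t => x t ω) (fun t => y t ω) (fun t => z t ω))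
    (hAPO : ∀ᵐ ω ∂μ, ISAD.SatisfiesAPO h φ
      (ISAD.lambdaMin ((ISAD.expMat π).transpose * ISAD.expMat π)) (fun t => Mbar t ω)
      (fun t => x t ω) (fun t => y t ω) (fun t => z t ω) (fun t => β t ω)) :
    ∀ᵐ ω ∂μ, ∀ xs ys zs : ISAD.Vec n,
      MapClusterPt (xs, ys, zs) atTop (fun t => (x t ω, y t ω, z t ω)) →
        xs ∈ ISAD.crit fun u =>
          (h u : EReal) + P ((ISAD.expMat π).toEuclideanLin u) := by
  obtain ⟨p, hp, hθp⟩ := hθ.exists_exponent hε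
  have hA : IsUnit (ISAD.expMat π) := ISAD.isUnit_of_rank_eq hrank
  have havg := ISAD.ae_average_tendsto hvar hp hθp hlaw hindep
    (hrun.mono fun ω hω => hω.average)
  filter_upwards [hrun, hbdd, hAPO, havg] with ω h1 h2 h3 h4 xs ys zs hcl
  -- For `n = 0` the spectrum is empty and `lambdaMin` is the default value `0`; but then the space
  -- is a single point, which is a minimizer.
  rcases Nat.eq_zero_or_pos n with rfl | hn
  · obtain ⟨u, hu⟩ := hPproper.2
    refine ISAD.mem_crit_of_isMin (EReal.add_ne_top (EReal.coe_ne_top _) ?_)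
      (EReal.add_ne_bot_iff.2 ⟨EReal.coe_ne_bot _, hPproper.1 _⟩)
      fun w => by rw [Subsingleton.elim w xs]
    rwa [Subsingleton.elim u ((ISAD.expMat π).toEuclideanLin xs)] at hu
  · have : NeZero n := ⟨hn.ne'⟩
    exact h1.mem_crit hh hφ hφconvex hPproper hPlsc hA h2 h3 h4.1 h4.2 hcl
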